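/- For $d>0$ and $x\in[0,d]$ write $\|x\|=\min\{x,d-x\}$. For a weight $h>0$ on $(0,d)$ let $$\mu_1(d,h)=\inf\Big\{\frac{\int_0^d h\,(f')^2}{\int_0^d h f^2}\ :\ f\in W^{1,2}(0,d),\ f\neq 0,\ \int_0^d hf=0\Big\}.$$ By a first Neumann eigenfunction of $([0,d],h\,dx)$ normalized at $0$ we mean a function $\phi\in C^1[0,d]$ with $$-(h\phi')'=\mu_1(d,h)\,h\,\phi\ \text{ on }(0,d),\qquad \phi(0)=-1,\qquad \phi'(0)=\phi'(d)=0.$$ Let $n\ge 2$. There is a constant $C=C(n)>0$ such that the estimates (1)--(4) below hold for every such $\phi$ in each of the following two situations. (a) $1\le d\le 2$ and $h>0$ is a function on $(0,d)$ for which $h^{1/(n-1)}$ is concave. (b) $\Omega\subseteq\mathbb R\times\mathbb R^{n-1}=\mathbb R^n$ is a bounded convex set with nonempty interior and $\mathrm{diam}(\Omega)=2$; the infimum and supremum over $\Omega$ of the first coordinate are $0$ and $d$; the orthogonal projection of $\Omega$ to $\{0\}\times\mathbb R^{n-1}$ has diameter at most $\frac1{20}$; and $h(x)$ is the $(n-1)$-dimensional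 volume of the slice $\{y:(x,y)\in\Omega\}$. The estimates are: 1. $\phi'(x)\ge C^{-1}\|x\|$ for all $x\in[0,d]$ with $\|x\|\le 10^{-n}$; 2. every $x_0\in[0,d]$ with $\phi(x_0)=0$ lies in $[10^{-n},\,d-10^{-n}]$; 3. $\sup_{x\in[0,d]}|\phi(x)|\le C$; 4. $0\le\phi'(x)\le C\|x\|$ for all $x\in[0,d]$. -/

import Mathlib

open MeasureTheory Set
open scoped ContDiff

namespace WeightedNeumann

noncomputable section

/-- The distance `‖x‖ = min {x, d - x}` of `x ∈ [0, d]` to the ends of the interval. -/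
def endDist (d x : ℝ) : ℝ := min x (d - x)

/-- `f ∈ W^{1,2}(0, d)` with weak derivative `g`: both are square integrable on `(0, d)`, and
`∫ f ψ' = - ∫ g ψ` for all smooth `ψ` with compact support in `(0, d)`. -/
structure IsSobolev (d : ℝ) (f g : ℝ → ℝ) : Prop where
  memLp : MemLp f 2 (volume.restrict (Ioo 0 d))
  memLp_deriv : MemLp g 2 (volume.restrict (Ioo 0 d))
  weak_deriv : ∀ ψ : ℝ → ℝ, ContDiff ℝ ∞ ψ → HasCompactSupport ψ → tsupport ψ ⊆ Ioo 0 d →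
    ∫ x in Ioo 0 d, f x * deriv ψ x = - ∫ x in Ioo 0 d, g x * ψ x

/-- The values of the Rayleigh quotient `∫ h (f')² / ∫ h f²` over all nonzero
`f ∈ W^{1,2}(0, d)` with `∫ h f = 0`. -/
def rayleighValues (d : ℝ) (h : ℝ → ℝ) : Set ℝ :=
  {r | ∃ f g : ℝ → ℝ, IsSobolev d f g ∧ ∫ x in Ioo 0 d, h x * f x = 0 ∧
    ¬ (f =ᵐ[volume.restrict (Ioo 0 d)] 0) ∧
    r = (∫ x in Ioo 0 d, h x * g x ^ 2) / ∫ x in Ioo 0 d, h x * f x ^ 2}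

/-- The first Neumann eigenvalue of the weighted interval `([0, d], h dx)`. -/
def firstNeumannEigenvalue (d : ℝ) (h : ℝ → ℝ) : ℝ := sInf (rayleighValues d h)

/-- `φ ∈ C¹[0, d]` is the first Neumann eigenfunction of `([0, d], h dx)` with `φ(0) = -1`:
`-(h φ')' = μ h φ` on `(0, d)`, where `μ` is the first Neumann eigenvalue, and
`φ'(0) = φ'(d) = 0`, with one-sided derivatives at the ends. -/
structure IsFirstNeumannEigenfunction (d : ℝ) (h φ : ℝ → ℝ) : Prop where
  contDiffOn : ContDiffOn ℝ 1 φ (Icc 0 d)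
  ode : ∀ x ∈ Ioo 0 d, HasDerivAt (fun t => h t * derivWithin φ (Icc 0 d) t)
    (-(firstNeumannEigenvalue d h * h x * φ x)) x
  map_zero : φ 0 = -1
  deriv_left : derivWithin φ (Icc 0 d) 0 = 0
  deriv_right : derivWithin φ (Icc 0 d) d = 0

/-- `h` is positive and `h^{1/(n-1)}` is concave on `(0, d)`. -/
structure IsConcaveWeight (n : ℕ) (d : ℝ) (h : ℝ → ℝ) : Prop where
  pos : ∀ x ∈ Ioo 0 d, 0 < h x
  concave : ConcaveOn ℝ (Ioo 0 d) (fun x => h x ^ (1 / ((n : ℝ) - 1)))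

/-- `ℝⁿ = ℝ × ℝⁿ⁻¹` with its Euclidean norm. -/
abbrev Space (n : ℕ) : Type := WithLp 2 (ℝ × EuclideanSpace ℝ (Fin (n - 1)))

/-- The `(n-1)`-dimensional volume `h(x)` of the slice `Ω_x = {(x, y) ∈ Ω}`. -/
def sliceVolume {n : ℕ} (Ω : Set (Space n)) (x : ℝ) : ℝ :=
  (volume {y : EuclideanSpace ℝ (Fin (n - 1)) | WithLp.toLp 2 (x, y) ∈ Ω}).toReal

/-- `Ω ⊆ ℝⁿ` is a bounded convex region of diameter `2` whose first coordinates span exactly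
the interval from `0` to `d`, and whose projection along the first axis has diameter at most
`1/20`. It may or may not contain parts of its boundary. -/
structure IsThinConvexRegion (n : ℕ) (Ω : Set (Space n)) (d : ℝ) : Prop where
  convex : Convex ℝ Ω
  bounded : Bornology.IsBounded Ω
  interior_nonempty : (interior Ω).Nonempty
  diam_eq : Metric.diam Ω = 2
  isGLB : IsGLB ((fun p : Space n => p.fst) '' Ω) 0
  isLUB : IsLUB ((fun p : Space n => p.fst) '' Ω) d
  diam_proj : Metric.diam ((fun p : Space n => p.snd) '' Ω) ≤ 1 / 20

/-- The estimates for `φ` on `[0, d]` with constant `C`; `φ'` is one-sided at the ends. -/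
structure Estimates (n : ℕ) (C d : ℝ) (φ : ℝ → ℝ) : Prop where
  deriv_lower : ∀ x ∈ Icc 0 d, endDist d x ≤ 1 / 10 ^ n →
    C⁻¹ * endDist d x ≤ derivWithin φ (Icc 0 d) x
  zero_mem : ∀ x₀ ∈ Icc 0 d, φ x₀ = 0 → x₀ ∈ Icc (1 / 10 ^ n) (d - 1 / 10 ^ n)
  abs_le : ∀ x ∈ Icc 0 d, |φ x| ≤ C
  deriv_nonneg : ∀ x ∈ Icc 0 d, 0 ≤ derivWithin φ (Icc 0 d) x
  deriv_upper : ∀ x ∈ Icc 0 d, derivWithin φ (Icc 0 d) x ≤ C * endDist d x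

end

end WeightedNeumann

/-! Put `p = n - 1`. All that is used about the weight is the cone condition `IsConeWeight`: `h(x) /
x ^ p` is antitone and `h(x) / (d - x) ^ p` is monotone. It follows from the homothety inequality `s
^ p * h(y) ≤ h((1 - s) * e + s * y)` by letting the centre `e` tend to an end of the interval.
Concavity of `h ^ (1 / p)` gives this inequality at once. For slices of a convex set it holds
because the slice over `(1 - s) * e + s * y` contains a copy of the slice over `y` shrunk by `s`;
Brunn-Minkowski is not needed.

The cone condition makes `h` comparable at points whose distances to an end are comparable. A
Poincaré inequality based at the midpoint and the test function `x - m` then bound the eigenvalue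
`μ` below and above in terms of `p`, as `1 ≤ d ≤ 2`.

The sign of `φ'` is variational. The flux `h φ'` vanishes at both ends and has derivative `-μ h φ`,
so it starts out positive. If it first vanished at an interior point `b`, then `φ(b) > 0`, and
`φ(min x b)`, corrected by its mean, would have a Rayleigh quotient below `μ` (`not_flux_eq_zero`).
Hence `φ' > 0` inside.

The estimates come from the mean value theorem for the flux. On `[0, x]` it gives `φ' ≤ C x`, hence
`φ` stays below half of its initial value on `[0, 10⁻ⁿ]`; on `[x / 2, x]` it then gives `φ' ≥ c x`.
The reflection `x ↦ d - x` transfers this to the right end, with amplitude `φ(d)` in place of `1`;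
`right_le_mul_left` shows that the two amplitudes are comparable. -/

namespace WeightedNeumann

/-! ### Weak derivatives on an interval -/

/-- A smooth function with compact support in `(0, d)` and integral zero is the derivative of
a smooth function with compact support in `(0, d)`. -/
lemma exists_primitive_of_integral_eq_zero {d : ℝ} (hd : 0 < d) {θ : ℝ → ℝ}
    (hθ : ContDiff ℝ ∞ θ) (hc : HasCompactSupport θ) (hs : tsupport θ ⊆ Ioo 0 d)
    (hint : ∫ x in Ioo 0 d, θ x = 0) :
    ∃ ψ : ℝ → ℝ, ContDiff ℝ ∞ ψ ∧ HasCompactSupport ψ ∧ tsupport ψ ⊆ Ioo 0 d ∧ deriv ψ = θ := by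
  have hint' : ∫ t in (0 : ℝ)..d, θ t = 0 := by
    rw [intervalIntegral.integral_of_le hd.le, integral_Ioc_eq_integral_Ioo, hint]
  have hder : ∀ x, HasDerivAt (fun x => ∫ t in (0 : ℝ)..x, θ t) (θ x) x := fun x =>
    intervalIntegral.integral_hasDerivAt_right (hθ.continuous.intervalIntegrable _ _)
      hθ.continuous.stronglyMeasurable.stronglyMeasurableAtFilter hθ.continuous.continuousAt
  have hderiv : deriv (fun x => ∫ t in (0 : ℝ)..x, θ t) = θ := funext fun x => (hder x).deriv
  -- The primitive from `0` vanishes to the left of `a`, where `θ` has not started, and to the right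
  -- of `b` because the total integral is zero.
  obtain ⟨a, b, ha, hb, hab⟩ : ∃ a b, 0 < a ∧ b < d ∧ tsupport θ ⊆ Icc a b := by
    rcases (tsupport θ).eq_empty_or_nonempty with he | hne
    · exact ⟨d / 2, d / 2, by linarith, by linarith, by simp [he]⟩
    · obtain ⟨a, ha, ha'⟩ := hc.isCompact.exists_isLeast hne
      obtain ⟨b, hb, hb'⟩ := hc.isCompact.exists_isGreatest hne
      exact ⟨a, b, (hs ha).1, (hs hb).2, fun x hx => ⟨ha' hx, hb' hx⟩⟩
  have hzero : ∀ t, t ∉ Icc a b → θ t = 0 := fun t ht =>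
    image_eq_zero_of_notMem_tsupport fun h => ht (hab h)
  have hsupp : tsupport (fun x => ∫ t in (0 : ℝ)..x, θ t) ⊆ Icc a b := by
    refine closure_minimal (fun x hx => ?_) isClosed_Icc
    by_contra hxn
    refine hx ?_
    change ∫ t in (0 : ℝ)..x, θ t = 0
    rw [mem_Icc, not_and_or, not_le, not_le] at hxn
    rcases hxn with h | h
    · rw [intervalIntegral.integral_congr (g := fun _ => (0 : ℝ))]
      · simp
      · intro t ht
        refine hzero t fun h' => ?_
        rcases le_total 0 x with h0 | h0
        · rw [uIcc_of_le h0] at ht; linarith [ht.2, h'.1]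
        · rw [uIcc_of_ge h0] at ht; linarith [ht.2, h'.1]
    · have h1 : ∫ t in (0 : ℝ)..x, θ t = (∫ t in (0 : ℝ)..d, θ t) + ∫ t in d..x, θ t :=
        (intervalIntegral.integral_add_adjacent_intervals
          (hθ.continuous.intervalIntegrable _ _) (hθ.continuous.intervalIntegrable _ _)).symm
      rw [h1, hint', zero_add, intervalIntegral.integral_congr (g := fun _ => (0 : ℝ))]
      · simp
      · intro t ht
        refine hzero t fun h' => ?_
        rcases le_total d x with h0 | h0
        · rw [uIcc_of_le h0] at ht; linarith [ht.1, h'.2]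
        · rw [uIcc_of_ge h0] at ht; linarith [ht.1, h'.2]
  refine ⟨fun x => ∫ t in (0 : ℝ)..x, θ t, ?_, ?_, ?_, hderiv⟩
  · exact contDiff_infty_iff_deriv.2 ⟨fun x => (hder x).differentiableAt, by rwa [hderiv]⟩
  · exact isCompact_Icc.of_isClosed_subset (isClosed_tsupport _) hsupp
  · exact hsupp.trans fun x hx => ⟨ha.trans_le hx.1, hx.2.trans_lt hb⟩

/-- **du Bois-Reymond lemma**: an integrable function on `(0, d)` that is orthogonal to the
derivatives of all test functions is constant. -/
lemma exists_ae_eq_const_of_integral_mul_deriv_eq_zero {d : ℝ} (hd : 0 < d) {k : ℝ → ℝ}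
    (hk : IntegrableOn k (Ioo 0 d))
    (h : ∀ ψ : ℝ → ℝ, ContDiff ℝ ∞ ψ → HasCompactSupport ψ → tsupport ψ ⊆ Ioo 0 d →
      ∫ x in Ioo 0 d, k x * deriv ψ x = 0) :
    ∃ c, ∀ᵐ x ∂(volume.restrict (Ioo 0 d)), k x = c := by
  -- A bump `ρ` of integral one identifies the constant as `∫ k ρ`: for a test function `η` with
  -- integral `I`, the difference `η - I ρ` has integral zero, so it is the derivative of a test
  -- function.
  let β : ContDiffBump (d / 2) := ⟨d / 8, d / 4, by linarith, by linarith⟩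
  set ρ : ℝ → ℝ := β.normed volume with hρ
  have hρs : tsupport ρ ⊆ Ioo 0 d := by
    rw [hρ, β.tsupport_normed_eq, Real.closedBall_eq_Icc]
    intro x hx
    have : β.rOut = d / 4 := rfl
    rw [this] at hx
    constructor <;> linarith [hx.1, hx.2]
  have hρ1 : ContDiff ℝ ∞ ρ := β.contDiff_normed
  have hρc : HasCompactSupport ρ := β.hasCompactSupport_normed
  have hfull : ∀ θ : ℝ → ℝ, tsupport θ ⊆ Ioo 0 d → ∫ x in Ioo 0 d, θ x = ∫ x, θ x :=
    fun θ hθ => setIntegral_eq_integral_of_forall_compl_eq_zero fun x hx =>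
      image_eq_zero_of_notMem_tsupport fun h' => hx (hθ h')
  have hρi : ∫ x in Ioo 0 d, ρ x = 1 := by rw [hfull ρ hρs]; exact β.integral_normed
  have hki : ∀ θ : ℝ → ℝ, Continuous θ → HasCompactSupport θ →
      IntegrableOn (fun x => k x * θ x) (Ioo 0 d) := by
    intro θ hθ hθc
    obtain ⟨M, hM⟩ := hθc.exists_bound_of_continuous hθ
    exact hk.mul_bdd hθ.aestronglyMeasurable (ae_of_all _ hM)
  set c := ∫ x in Ioo 0 d, k x * ρ x with hcdef
  refine ⟨c, ?_⟩
  have hloc : LocallyIntegrableOn (fun x => k x - c) (Ioo 0 d) :=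
    (hk.sub (integrableOn_const (by simp))).locallyIntegrableOn
  have := isOpen_Ioo.ae_eq_zero_of_integral_contDiff_smul_eq_zero hloc ?_
  · rw [ae_restrict_iff' measurableSet_Ioo]
    filter_upwards [this] with x hx hx'
    exact sub_eq_zero.1 (hx hx')
  intro η hη hηc hηs
  have hηi : IntegrableOn η (Ioo 0 d) := (hη.continuous.integrable_of_hasCompactSupport hηc).integrableOn
  have hρi' : IntegrableOn ρ (Ioo 0 d) := (hρ1.continuous.integrable_of_hasCompactSupport hρc).integrableOn
  set I := ∫ x in Ioo 0 d, η x with hI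
  have hts : tsupport (fun x => η x - I * ρ x) ⊆ Ioo 0 d := by
    refine (tsupport_sub η (fun x => I * ρ x)).trans (union_subset hηs ?_)
    exact (tsupport_mul_subset_right (f := fun _ => I) (g := ρ)).trans hρs
  obtain ⟨ψ, h1, h2, h3, h4⟩ := exists_primitive_of_integral_eq_zero hd
    (θ := fun x => η x - I * ρ x) (hη.sub (contDiff_const.mul hρ1))
    (hηc.sub hρc.mul_left) hts (by
      rw [integral_sub hηi (hρi'.const_mul I), integral_const_mul, hρi, ← hI]; ring)
  have h5 := h ψ h1 h2 h3
  rw [h4] at h5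
  have h6 : ∫ x in Ioo 0 d, k x * (η x - I * ρ x) = (∫ x in Ioo 0 d, k x * η x) - I * c := by
    rw [hcdef, ← integral_const_mul, ← integral_sub (hki η hη.continuous hηc)
      ((hki ρ hρ1.continuous hρc).const_mul I)]
    exact integral_congr_ae (ae_of_all _ fun x => by ring)
  have h7 : ∫ x, η x • (k x - c) = ∫ x in Ioo 0 d, η x • (k x - c) := by
    refine (hfull _ ((tsupport_mul_subset_left (f := η) (g := fun x => k x - c)).trans hηs)).symm
  rw [h7]
  have h8 : ∫ x in Ioo 0 d, η x • (k x - c) = (∫ x in Ioo 0 d, k x * η x) - c * I := by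
    rw [hI, ← integral_const_mul, ← integral_sub (hki η hη.continuous hηc) (hηi.const_mul c)]
    exact integral_congr_ae (ae_of_all _ fun x => by simp; ring)
  rw [h8]
  linarith

lemma eq_zero_of_tsupport_subset_Ioo {a b : ℝ} {ψ : ℝ → ℝ} (h : tsupport ψ ⊆ Ioo a b) :
    ψ a = 0 ∧ ψ b = 0 :=
  ⟨image_eq_zero_of_notMem_tsupport fun h' => lt_irrefl _ (h h').1,
    image_eq_zero_of_notMem_tsupport fun h' => lt_irrefl _ (h h').2⟩

/-- A Sobolev function agrees almost everywhere with a primitive of its weak derivative. -/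
lemma IsSobolev.exists_ae_eq_primitive {d : ℝ} (hd : 0 < d) {f g : ℝ → ℝ}
    (h : IsSobolev d f g) :
    ∃ c, ∀ᵐ x ∂(volume.restrict (Ioo 0 d)), f x = c + ∫ t in (0 : ℝ)..x, g t := by
  have hf : IntegrableOn f (Ioo 0 d) := h.memLp.integrable one_le_two
  have hg : IntegrableOn g (Ioo 0 d) := h.memLp_deriv.integrable one_le_two
  have hgi : IntervalIntegrable g volume 0 d := by
    rwa [intervalIntegrable_iff_integrableOn_Ioo_of_le hd.le]
  set G : ℝ → ℝ := fun x => ∫ t in (0 : ℝ)..x, g t with hG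
  have hGac : AbsolutelyContinuousOnInterval G 0 d :=
    hgi.absolutelyContinuousOnInterval_intervalIntegral (by simp)
  have hGc : ContinuousOn G (Icc 0 d) := by
    have := hGac.continuousOn; rwa [uIcc_of_le hd.le] at this
  have hGi : IntegrableOn G (Ioo 0 d) := hGc.integrableOn_Icc.mono_set Ioo_subset_Icc_self
  -- The primitive `G` is absolutely continuous, so integration by parts gives it the same weak
  -- derivative `g`; thus `f - G` is orthogonal to every `ψ'`.
  obtain ⟨c, hc⟩ := exists_ae_eq_const_of_integral_mul_deriv_eq_zero hd (hf.sub hGi) (by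
    intro ψ h1 h2 h3
    have hψ := h.weak_deriv ψ h1 h2 h3
    have hψac : AbsolutelyContinuousOnInterval ψ 0 d :=
      (h1.of_le (by simp)).contDiffOn.absolutelyContinuousOnInterval
    have hparts := hGac.integral_mul_deriv_eq_deriv_mul hψac
    obtain ⟨h4, h5⟩ := eq_zero_of_tsupport_subset_Ioo h3
    have hae : ∫ x in (0 : ℝ)..d, deriv G x * ψ x = ∫ x in (0 : ℝ)..d, g x * ψ x := by
      refine intervalIntegral.integral_congr_ae ?_
      filter_upwards [hgi.ae_hasDerivAt_integral] with x hx hx'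
      rw [(hx (uIoc_subset_uIcc hx') 0 (by simp)).deriv]
    rw [hae, h4, h5, intervalIntegral.integral_of_le hd.le, intervalIntegral.integral_of_le hd.le,
      integral_Ioc_eq_integral_Ioo, integral_Ioc_eq_integral_Ioo] at hparts
    have hdc : Continuous (deriv ψ) := h1.continuous_deriv (by simp)
    obtain ⟨M, hM⟩ := h2.deriv.exists_bound_of_continuous hdc
    have e : ∀ x, (f - G) x * deriv ψ x = f x * deriv ψ x - G x * deriv ψ x := fun x => by
      simp only [Pi.sub_apply]; ring
    simp_rw [e]
    rw [integral_sub (hf.mul_bdd hdc.aestronglyMeasurable (ae_of_all _ hM))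
      (hGi.mul_bdd hdc.aestronglyMeasurable (ae_of_all _ hM)), hψ, hparts]
    ring)
  refine ⟨c, ?_⟩
  filter_upwards [hc] with x hx
  simp only [Pi.sub_apply] at hx
  linarith

/-- A function that is `C¹` up to the boundary is Sobolev. -/
lemma isSobolev_of_hasDerivAt {d : ℝ} (hd : 0 < d) {f g : ℝ → ℝ} (hf : ContinuousOn f (Icc 0 d))
    (hg : ContinuousOn g (Icc 0 d)) (hfg : ∀ x ∈ Ioo 0 d, HasDerivAt f (g x) x) :
    IsSobolev d f g := by
  have hmem : ∀ k : ℝ → ℝ, ContinuousOn k (Icc 0 d) → MemLp k 2 (volume.restrict (Ioo 0 d)) := by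
    intro k hk
    obtain ⟨M, hM⟩ := isCompact_Icc.exists_bound_of_continuousOn hk
    refine MemLp.of_bound ((hk.mono Ioo_subset_Icc_self).aestronglyMeasurable measurableSet_Ioo) M ?_
    exact (ae_restrict_iff' measurableSet_Ioo).2 (ae_of_all _ fun x hx => hM x (Ioo_subset_Icc_self hx))
  refine ⟨hmem f hf, hmem g hg, fun ψ h1 h2 h3 => ?_⟩
  obtain ⟨h4, h5⟩ := eq_zero_of_tsupport_subset_Ioo h3
  rw [← integral_Ioc_eq_integral_Ioo, ← integral_Ioc_eq_integral_Ioo,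
    ← intervalIntegral.integral_of_le hd.le, ← intervalIntegral.integral_of_le hd.le,
    intervalIntegral.integral_mul_deriv_eq_deriv_mul_of_hasDerivAt (u' := g)
      (by rwa [uIcc_of_le hd.le]) h1.continuous.continuousOn
      (by rwa [min_eq_left hd.le, max_eq_right hd.le])
      (fun x _ => (h1.differentiable (by simp) x).hasDerivAt)
      (hg.intervalIntegrable_of_Icc hd.le)
      ((h1.continuous_deriv (by simp)).intervalIntegrable _ _), h4, h5]
  ring

/-! ### Cone weights -/

/-- A positive weight `h` on `(0, d)` such that `h(x) / x ^ p` is antitone and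
`h(x) / (d - x) ^ p` is monotone. -/
structure IsConeWeight (p : ℕ) (d : ℝ) (h : ℝ → ℝ) : Prop where
  pos : ∀ x ∈ Ioo 0 d, 0 < h x
  left : ∀ x ∈ Ioo 0 d, ∀ y ∈ Ioo 0 d, x ≤ y → h y * x ^ p ≤ h x * y ^ p
  right : ∀ x ∈ Ioo 0 d, ∀ y ∈ Ioo 0 d, x ≤ y → h x * (d - y) ^ p ≤ h y * (d - x) ^ p

namespace IsConeWeight

variable {p : ℕ} {d : ℝ} {h : ℝ → ℝ}

lemma reflect (hw : IsConeWeight p d h) : IsConeWeight p d (fun x => h (d - x)) := by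
  have hm : ∀ x ∈ Ioo 0 d, d - x ∈ Ioo 0 d := fun x hx => ⟨by linarith [hx.2], by linarith [hx.1]⟩
  refine ⟨fun x hx => hw.pos _ (hm x hx), fun x hx y hy hxy => ?_, fun x hx y hy hxy => ?_⟩
  · have := hw.right _ (hm y hy) _ (hm x hx) (by linarith)
    simpa using this
  · exact hw.left _ (hm y hy) _ (hm x hx) (by linarith)

/-- The ratio `h y / h x` is at most `(y / x) ^ p`. This and its mirror image are the only ways in
which values of the weight are compared below. -/
lemma le_of_left (hw : IsConeWeight p d h) {x y K : ℝ} (hx : x ∈ Ioo 0 d) (hy : y ∈ Ioo 0 d)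
    (hxy : x ≤ y) (hK : y ≤ K * x) : h y ≤ K ^ p * h x := by
  have h1 := hw.left x hx y hy hxy
  have h2 : y ^ p ≤ (K * x) ^ p := pow_le_pow_left₀ hy.1.le hK p
  rw [mul_pow] at h2
  refine le_of_mul_le_mul_right ?_ (pow_pos hx.1 p)
  nlinarith [hw.pos x hx]

lemma le_of_right (hw : IsConeWeight p d h) {x y K : ℝ} (hx : x ∈ Ioo 0 d) (hy : y ∈ Ioo 0 d)
    (hxy : x ≤ y) (hK : d - x ≤ K * (d - y)) : h x ≤ K ^ p * h y := by
  have := hw.reflect.le_of_left (x := d - y) (y := d - x) (K := K)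
    ⟨by linarith [hy.2], by linarith [hy.1]⟩ ⟨by linarith [hx.2], by linarith [hx.1]⟩
    (by linarith) hK
  simpa using this

lemma le_mid (hw : IsConeWeight p d h) {x : ℝ} (hx : x ∈ Ioo 0 d) : h x ≤ 2 ^ p * h (d / 2) := by
  have hm : d / 2 ∈ Ioo 0 d := ⟨by linarith [hx.1, hx.2], by linarith [hx.1, hx.2]⟩
  rcases le_total x (d / 2) with hle | hle
  · exact hw.le_of_right hx hm hle (by linarith [hx.1])
  · exact hw.le_of_left hm hx hle (by linarith [hx.2])

lemma mid_le (hw : IsConeWeight p d h) {x : ℝ} (hx : x ∈ Ioo 0 d) (h1 : d / 4 ≤ x)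
    (h2 : x ≤ 3 * d / 4) : h (d / 2) ≤ 2 ^ p * h x := by
  have hm : d / 2 ∈ Ioo 0 d := ⟨by linarith [hx.1, hx.2], by linarith [hx.1, hx.2]⟩
  rcases le_total x (d / 2) with hle | hle
  · exact hw.le_of_left hx hm hle (by linarith [hx.1])
  · exact hw.le_of_right hm hx hle (by linarith [hx.2])

/-- Measurability of the weight is not assumed; it comes from the monotonicity of `h x / x ^ p`. -/
lemma aestronglyMeasurable (hw : IsConeWeight p d h) :
    AEStronglyMeasurable h (volume.restrict (Ioo 0 d)) := by
  have hanti : AntitoneOn (fun x => h x / x ^ p) (Ioo 0 d) := by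
    intro x hx y hy hxy
    exact (div_le_div_iff₀ (pow_pos hy.1 p) (pow_pos hx.1 p)).2 (hw.left x hx y hy hxy)
  have h1 : AEMeasurable (fun x => h x / x ^ p * x ^ p) (volume.restrict (Ioo 0 d)) :=
    (aemeasurable_restrict_of_antitoneOn measurableSet_Ioo hanti).mul (by fun_prop)
  refine (h1.congr ?_).aestronglyMeasurable
  refine (ae_restrict_iff' measurableSet_Ioo).2 (ae_of_all _ fun x hx => ?_)
  exact div_mul_cancel₀ _ (pow_pos hx.1 p).ne'

lemma integrableOn_mul (hw : IsConeWeight p d h) {F : ℝ → ℝ} (hF : IntegrableOn F (Ioo 0 d)) :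
    IntegrableOn (fun x => h x * F x) (Ioo 0 d) := by
  refine hF.bdd_mul (c := 2 ^ p * h (d / 2)) hw.aestronglyMeasurable ?_
  refine (ae_restrict_iff' measurableSet_Ioo).2 (ae_of_all _ fun x hx => ?_)
  rw [Real.norm_of_nonneg (hw.pos x hx).le]
  exact hw.le_mid hx

lemma integrableOn (hw : IsConeWeight p d h) : IntegrableOn h (Ioo 0 d) := by
  simpa using hw.integrableOn_mul (F := fun _ => 1) (integrableOn_const (by simp))

lemma integrableOn_mul_continuousOn (hw : IsConeWeight p d h) {F : ℝ → ℝ}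
    (hF : ContinuousOn F (Icc 0 d)) : IntegrableOn (fun x => h x * F x) (Ioo 0 d) :=
  hw.integrableOn_mul (hF.integrableOn_Icc.mono_set Ioo_subset_Icc_self)

lemma integral_pos (hw : IsConeWeight p d h) (hd : 0 < d) : 0 < ∫ x in Ioo 0 d, h x := by
  rw [setIntegral_pos_iff_support_of_nonneg_ae]
  · have : Function.support h ∩ Ioo 0 d = Ioo 0 d :=
      inter_eq_right.2 fun x hx => (hw.pos x hx).ne'
    rw [this]; simpa using hd
  · exact (ae_restrict_iff' measurableSet_Ioo).2 (ae_of_all _ fun x hx => (hw.pos x hx).le)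
  · exact hw.integrableOn

lemma integral_mul_sq_nonneg (hw : IsConeWeight p d h) (F : ℝ → ℝ) :
    0 ≤ ∫ x in Ioo 0 d, h x * F x ^ 2 :=
  setIntegral_nonneg measurableSet_Ioo fun x hx => mul_nonneg (hw.pos x hx).le (sq_nonneg _)

lemma integral_mul_sq_pos (hw : IsConeWeight p d h) {F : ℝ → ℝ}
    (hF : MemLp F 2 (volume.restrict (Ioo 0 d)))
    (h0 : ¬ (F =ᵐ[volume.restrict (Ioo 0 d)] 0)) : 0 < ∫ x in Ioo 0 d, h x * F x ^ 2 := by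
  refine (hw.integral_mul_sq_nonneg F).lt_of_ne' fun hz => h0 ?_
  rw [setIntegral_eq_zero_iff_of_nonneg_ae ?_ (hw.integrableOn_mul hF.integrable_sq)] at hz
  · filter_upwards [hz, ae_restrict_mem measurableSet_Ioo] with x hx hx'
    simpa [(hw.pos x hx').ne'] using hx
  · exact (ae_restrict_iff' measurableSet_Ioo).2
      (ae_of_all _ fun x hx => mul_nonneg (hw.pos x hx).le (sq_nonneg _))

lemma integral_mul_sub_sq (hw : IsConeWeight p d h) {F : ℝ → ℝ}
    (hF : MemLp F 2 (volume.restrict (Ioo 0 d))) (m : ℝ) :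
    ∫ x in Ioo 0 d, h x * (F x - m) ^ 2 = (∫ x in Ioo 0 d, h x * F x ^ 2) -
      2 * m * (∫ x in Ioo 0 d, h x * F x) + m ^ 2 * ∫ x in Ioo 0 d, h x := by
  have i1 := hw.integrableOn_mul hF.integrable_sq
  have i2 := hw.integrableOn_mul (F := F) (hF.integrable one_le_two)
  have i3 : IntegrableOn (fun x => h x * F x ^ 2 - 2 * m * (h x * F x)) (Ioo 0 d) :=
    i1.sub (i2.const_mul _)
  rw [← integral_const_mul, ← integral_const_mul, ← integral_sub i1 (i2.const_mul _),
    ← integral_add i3 (hw.integrableOn.const_mul _)]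
  exact integral_congr_ae (ae_of_all _ fun x => by simp only; ring)

end IsConeWeight

/-! ### Poincaré inequality and bounds for the first eigenvalue -/

/-- The Cauchy-Schwarz inequality against the constant function `1`. -/
lemma sq_setIntegral_le {s : Set ℝ} (hs : volume s ≠ ⊤) {g : ℝ → ℝ}
    (hg : MemLp g 2 (volume.restrict s)) :
    (∫ x in s, g x) ^ 2 ≤ volume.real s * ∫ x in s, g x ^ 2 := by
  have : IsFiniteMeasure (volume.restrict s) := ⟨by simpa using hs.lt_top⟩
  have i1 := hg.integrable_sq
  have i2 : IntegrableOn g s := hg.integrable one_le_two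
  set a := ∫ x in s, g x with ha
  set L := volume.real s with hL
  rcases (measureReal_nonneg : 0 ≤ L).eq_or_lt with h0 | hpos
  · have : volume s = 0 := by
      exact (measureReal_eq_zero_iff hs).1 h0.symm
    have : a = 0 := by rw [ha, Measure.restrict_eq_zero.2 this, integral_zero_measure]
    rw [this, show L = 0 from h0.symm]; simp
  -- Cauchy-Schwarz is the nonnegativity of this integral, divided by `L`.
  have key : ∫ x in s, (L * g x - a) ^ 2 = L ^ 2 * (∫ x in s, g x ^ 2) - 2 * L * a * a + a ^ 2 * L := by
    have : ∫ x in s, a ^ 2 = a ^ 2 * L := by simp [hL, mul_comm]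
    have i3 : IntegrableOn (fun x => L ^ 2 * g x ^ 2 - 2 * L * a * g x) s :=
      (i1.const_mul _).sub (i2.const_mul _)
    have e : 2 * L * a * a = ∫ x in s, 2 * L * a * g x := by rw [integral_const_mul]
    rw [← this, e, ← integral_const_mul, ← integral_sub (i1.const_mul _) (i2.const_mul _),
      ← integral_add i3 (integrable_const _)]
    exact integral_congr_ae (ae_of_all _ fun x => by simp only; ring)
  have hnn : 0 ≤ ∫ x in s, (L * g x - a) ^ 2 := integral_nonneg fun x => sq_nonneg _
  rw [key] at hnn
  refine le_of_mul_le_mul_left ?_ hpos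
  nlinarith

/-- The primitive is based at the midpoint because every `t` between `d / 2` and `x` satisfies `h x
≤ 2 ^ p * h t`. The weight can therefore be moved inside the integral even if it degenerates at the
ends. -/
lemma IsConeWeight.mul_sq_integral_mid_le {p : ℕ} {d : ℝ} {h g : ℝ → ℝ} (hw : IsConeWeight p d h)
    (hg : MemLp g 2 (volume.restrict (Ioo 0 d))) {x : ℝ} (hx : x ∈ Ioo 0 d) :
    h x * (∫ t in (d / 2)..x, g t) ^ 2 ≤ d * 2 ^ p * ∫ t in Ioo 0 d, h t * g t ^ 2 := by
  have hd : 0 < d := hx.1.trans hx.2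
  have hm : d / 2 ∈ Ioo 0 d := ⟨by linarith, by linarith⟩
  have hsub : uIoc (d / 2) x ⊆ Ioo 0 d := fun t ht => by
    rcases le_total (d / 2) x with hle | hle
    · rw [uIoc_of_le hle] at ht; exact ⟨by linarith [ht.1], by linarith [ht.2, hx.2]⟩
    · rw [uIoc_of_ge hle] at ht; exact ⟨by linarith [ht.1, hx.1], by linarith [ht.2]⟩
  have hcomp : ∀ t ∈ uIoc (d / 2) x, h x ≤ 2 ^ p * h t := fun t ht => by
    have ht' := hsub ht
    rcases le_total (d / 2) x with hle | hle
    · rw [uIoc_of_le hle] at ht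
      exact hw.le_of_left ht' hx ht.2 (by linarith [ht.1, hx.2])
    · rw [uIoc_of_ge hle] at ht
      exact hw.le_of_right hx ht' ht.1.le (by linarith [ht.2, hx.1])
  have hg' := hg.mono_measure (Measure.restrict_mono hsub le_rfl)
  have hfin : volume (uIoc (d / 2) x) ≠ ⊤ := by simp [uIoc]
  have hlen : volume.real (uIoc (d / 2) x) ≤ d := by
    calc volume.real (uIoc (d / 2) x) ≤ volume.real (Ioo 0 d) := measureReal_mono hsub (by simp)
      _ = d := by simp [hd.le]
  have hcs := sq_setIntegral_le hfin hg'
  have hsq : (∫ t in (d / 2)..x, g t) ^ 2 = (∫ t in uIoc (d / 2) x, g t) ^ 2 := by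
    rw [← sq_abs, intervalIntegral.abs_intervalIntegral_eq, sq_abs]
  have i1 : IntegrableOn (fun t => h t * g t ^ 2) (Ioo 0 d) := hw.integrableOn_mul hg.integrable_sq
  have h1 : h x * ∫ t in uIoc (d / 2) x, g t ^ 2 ≤ 2 ^ p * ∫ t in uIoc (d / 2) x, h t * g t ^ 2 := by
    rw [← integral_const_mul, ← integral_const_mul]
    refine setIntegral_mono_on (hg'.integrable_sq.const_mul _) ((i1.mono_set hsub).const_mul _)
      measurableSet_uIoc fun t ht => ?_
    nlinarith [hcomp t ht, sq_nonneg (g t)]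
  have h2 : ∫ t in uIoc (d / 2) x, h t * g t ^ 2 ≤ ∫ t in Ioo 0 d, h t * g t ^ 2 := by
    refine setIntegral_mono_set i1 ?_ (ae_of_all _ hsub)
    exact (ae_restrict_iff' measurableSet_Ioo).2
      (ae_of_all _ fun t ht => mul_nonneg (hw.pos t ht).le (sq_nonneg _))
  have h3 : 0 ≤ ∫ t in uIoc (d / 2) x, g t ^ 2 := integral_nonneg fun t => sq_nonneg _
  rw [hsq]
  calc h x * (∫ t in uIoc (d / 2) x, g t) ^ 2
      ≤ h x * (d * ∫ t in uIoc (d / 2) x, g t ^ 2) :=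
        mul_le_mul_of_nonneg_left (hcs.trans (mul_le_mul_of_nonneg_right hlen h3)) (hw.pos x hx).le
    _ = d * (h x * ∫ t in uIoc (d / 2) x, g t ^ 2) := by ring
    _ ≤ d * (2 ^ p * ∫ t in Ioo 0 d, h t * g t ^ 2) :=
        mul_le_mul_of_nonneg_left (h1.trans (mul_le_mul_of_nonneg_left h2 (by positivity))) hd.le
    _ = _ := by ring

/-- The weighted Poincaré inequality. -/
lemma IsConeWeight.poincare {p : ℕ} {d : ℝ} {h f g : ℝ → ℝ} (hw : IsConeWeight p d h) (hd : 0 < d)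
    (hs : IsSobolev d f g) (hmean : ∫ x in Ioo 0 d, h x * f x = 0) :
    ∫ x in Ioo 0 d, h x * f x ^ 2 ≤ d ^ 2 * 2 ^ p * ∫ x in Ioo 0 d, h x * g x ^ 2 := by
  obtain ⟨c, hc⟩ := hs.exists_ae_eq_primitive hd
  set J := ∫ x in Ioo 0 d, h x * g x ^ 2
  have hgi : IntervalIntegrable g volume 0 d := by
    rw [intervalIntegrable_iff_integrableOn_Ioo_of_le hd.le]
    exact hs.memLp_deriv.integrable one_le_two
  set c' := c + ∫ t in (0 : ℝ)..(d / 2), g t with hc'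
  have hle : ∫ x in Ioo 0 d, h x * (f x - c') ^ 2 ≤ ∫ x in Ioo 0 d, d * 2 ^ p * J := by
    refine integral_mono_ae ?_ (integrable_const _) ?_
    · exact hw.integrableOn_mul (hs.memLp.sub (memLp_const c')).integrable_sq
    · filter_upwards [hc, ae_restrict_mem measurableSet_Ioo] with x hx hx'
      have : f x - c' = ∫ t in (d / 2)..x, g t := by
        rw [hx, hc', ← intervalIntegral.integral_interval_sub_left (a := 0) (b := x) (c := d / 2)
          (hgi.mono_set ?_) (hgi.mono_set ?_)]
        · ring
        · rw [uIcc_of_le hx'.1.le, uIcc_of_le hd.le]; exact Icc_subset_Icc_right hx'.2.le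
        · rw [uIcc_of_le (by linarith), uIcc_of_le hd.le]; exact Icc_subset_Icc_right (by linarith)
      rw [this]
      exact hw.mul_sq_integral_mid_le hs.memLp_deriv hx'
  rw [hw.integral_mul_sub_sq hs.memLp, hmean] at hle
  have hvol : ∫ x in Ioo 0 d, d * 2 ^ p * J = d ^ 2 * 2 ^ p * J := by
    simp [hd.le]; ring
  rw [hvol] at hle
  nlinarith [mul_nonneg (sq_nonneg c') (hw.integral_pos hd).le]

lemma IsConeWeight.le_of_mem_rayleighValues {p : ℕ} {d : ℝ} {h : ℝ → ℝ} (hw : IsConeWeight p d h)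
    (hd : 0 < d) {r : ℝ} (hr : r ∈ rayleighValues d h) : 1 / (d ^ 2 * 2 ^ p) ≤ r := by
  obtain ⟨f, g, hs, hmean, h0, rfl⟩ := hr
  have hD := hw.integral_mul_sq_pos hs.memLp h0
  rw [div_le_div_iff₀ (by positivity) hD]
  have := hw.poincare hd hs hmean
  linarith

/-- The variational characterization applied to the deviation of a `C¹` function from its mean. -/
lemma IsConeWeight.firstNeumannEigenvalue_mul_le {p : ℕ} {d : ℝ} {h f g : ℝ → ℝ}
    (hw : IsConeWeight p d h) (hd : 0 < d) (hf : ContinuousOn f (Icc 0 d))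
    (hg : ContinuousOn g (Icc 0 d)) (hfg : ∀ x ∈ Ioo 0 d, HasDerivAt f (g x) x) {m : ℝ}
    (hm : m * ∫ x in Ioo 0 d, h x = ∫ x in Ioo 0 d, h x * f x) :
    firstNeumannEigenvalue d h * ∫ x in Ioo 0 d, h x * (f x - m) ^ 2 ≤
      ∫ x in Ioo 0 d, h x * g x ^ 2 := by
  rcases (hw.integral_mul_sq_nonneg fun x => f x - m).eq_or_lt with h0 | hpos
  · rw [← h0, mul_zero]; exact hw.integral_mul_sq_nonneg g
  rw [← le_div_iff₀ hpos]
  refine csInf_le ⟨1 / (d ^ 2 * 2 ^ p), fun r hr => hw.le_of_mem_rayleighValues hd hr⟩ ?_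
  refine ⟨fun x => f x - m, g, isSobolev_of_hasDerivAt hd (hf.sub continuousOn_const) hg
    fun x hx => (hfg x hx).sub_const m, ?_, fun hz => ?_, rfl⟩
  · simp_rw [mul_sub]
    rw [integral_sub (hw.integrableOn_mul_continuousOn hf) (hw.integrableOn.mul_const m),
      integral_mul_const, ← hm]
    ring
  · refine hpos.ne' ?_
    rw [integral_congr_ae (g := fun _ => (0 : ℝ)), integral_zero]
    filter_upwards [hz] with x hx
    simp only [Pi.zero_apply] at hx
    simp [hx]

lemma IsConeWeight.firstNeumannEigenvalue_le {p : ℕ} {d : ℝ} {h : ℝ → ℝ}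
    (hw : IsConeWeight p d h) (hd : 0 < d) : firstNeumannEigenvalue d h * d ^ 2 ≤ 96 * 4 ^ p := by
  set μ := firstNeumannEigenvalue d h with hμ
  have hH := hw.integral_pos hd
  set m := (∫ x in Ioo 0 d, h x * x) / ∫ x in Ioo 0 d, h x with hm
  have key := hw.firstNeumannEigenvalue_mul_le hd (f := fun x => x) (g := fun _ => 1) (m := m)
    continuousOn_id continuousOn_const (fun x _ => hasDerivAt_id x)
    (div_mul_cancel₀ _ hH.ne')
  rw [← hμ] at key
  have hm0 : d / 2 ∈ Ioo 0 d := ⟨by linarith, by linarith⟩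
  have hpos := hw.pos _ hm0
  have hup : ∫ x in Ioo 0 d, h x * (1 : ℝ) ^ 2 ≤ 2 ^ p * h (d / 2) * d := by
    calc ∫ x in Ioo 0 d, h x * (1 : ℝ) ^ 2 ≤ ∫ x in Ioo 0 d, 2 ^ p * h (d / 2) := by
          refine setIntegral_mono_on (by simpa using hw.integrableOn) (integrableOn_const (by simp))
            measurableSet_Ioo fun x hx => ?_
          simpa using hw.le_mid hx
      _ = _ := by simp [hd.le]; ring
  have hsub : Ioc (d / 4) (3 * d / 4) ⊆ Ioo 0 d := fun x hx =>
    ⟨by linarith [hx.1], by linarith [hx.2]⟩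
  have i1 : IntegrableOn (fun x => h x * (x - m) ^ 2) (Ioo 0 d) :=
    hw.integrableOn_mul_continuousOn (by fun_prop)
  -- The integral of `(x - m) ^ 2` over an interval of length `d / 2` is least when `m` is its
  -- centre, with value `(d / 2) ^ 3 / 12`; so the position of the mean does not matter.
  have hpoly : d ^ 3 / 96 ≤ ∫ x in Ioc (d / 4) (3 * d / 4), (x - m) ^ 2 := by
    rw [← intervalIntegral.integral_of_le (by linarith), intervalIntegral.integral_comp_sub_right
      (fun x => x ^ 2), integral_pow]
    norm_num
    nlinarith [mul_nonneg hd.le (sq_nonneg (m - d / 2))]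
  have hlow : h (d / 2) * (d ^ 3 / 96) ≤ 2 ^ p * ∫ x in Ioo 0 d, h x * (x - m) ^ 2 := by
    calc h (d / 2) * (d ^ 3 / 96)
        ≤ h (d / 2) * ∫ x in Ioc (d / 4) (3 * d / 4), (x - m) ^ 2 :=
          mul_le_mul_of_nonneg_left hpoly hpos.le
      _ ≤ 2 ^ p * ∫ x in Ioc (d / 4) (3 * d / 4), h x * (x - m) ^ 2 := by
          rw [← integral_const_mul, ← integral_const_mul]
          refine setIntegral_mono_on ?_ ((i1.mono_set hsub).const_mul _) measurableSet_Ioc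
            fun x hx => ?_
          · exact (Continuous.integrableOn_Icc (by fun_prop)).mono_set Ioc_subset_Icc_self
          · nlinarith [hw.mid_le (hsub hx) hx.1.le hx.2, sq_nonneg (x - m)]
      _ ≤ 2 ^ p * ∫ x in Ioo 0 d, h x * (x - m) ^ 2 := by
          refine mul_le_mul_of_nonneg_left (setIntegral_mono_set i1 ?_ (ae_of_all _ hsub))
            (by positivity)
          exact (ae_restrict_iff' measurableSet_Ioo).2
            (ae_of_all _ fun t ht => mul_nonneg (hw.pos t ht).le (sq_nonneg _))
  rcases le_total μ 0 with h0 | h0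
  · nlinarith [mul_nonneg (neg_nonneg.2 h0) (sq_nonneg d), show (0 : ℝ) ≤ 96 * 4 ^ p by positivity]
  have h4 : (4 : ℝ) ^ p = 2 ^ p * 2 ^ p := by rw [← mul_pow]; norm_num
  have h1 : μ * (h (d / 2) * (d ^ 3 / 96)) ≤ 2 ^ p * (2 ^ p * h (d / 2) * d) := by
    calc μ * (h (d / 2) * (d ^ 3 / 96)) ≤ μ * (2 ^ p * ∫ x in Ioo 0 d, h x * (x - m) ^ 2) :=
          mul_le_mul_of_nonneg_left hlow h0
      _ = 2 ^ p * (μ * ∫ x in Ioo 0 d, h x * (x - m) ^ 2) := by ring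
      _ ≤ _ := mul_le_mul_of_nonneg_left (key.trans hup) (by positivity)
  refine le_of_mul_le_mul_right ?_ (mul_pos hpos hd)
  rw [h4]
  nlinarith

lemma IsConeWeight.le_firstNeumannEigenvalue {p : ℕ} {d : ℝ} {h : ℝ → ℝ}
    (hw : IsConeWeight p d h) (hd : 0 < d) : 1 / (d ^ 2 * 2 ^ p) ≤ firstNeumannEigenvalue d h := by
  -- The set of values must be shown nonempty, since the real infimum of the empty set is `0`; `x -
  -- m` provides an element.
  refine le_csInf ?_ fun r hr => hw.le_of_mem_rayleighValues hd hr
  have hH := hw.integral_pos hd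
  set m := (∫ x in Ioo 0 d, h x * x) / ∫ x in Ioo 0 d, h x with hm
  refine ⟨_, fun x => x - m, fun _ => 1, isSobolev_of_hasDerivAt hd (by fun_prop)
    continuousOn_const fun x hx => (hasDerivAt_id x).sub_const m, ?_, fun hz => ?_, rfl⟩
  · simp_rw [mul_sub]
    rw [integral_sub (hw.integrableOn_mul_continuousOn (F := fun x => x) (by fun_prop))
      (hw.integrableOn.mul_const m), integral_mul_const, hm, mul_div_cancel₀ _ hH.ne', sub_self]
  · have h1 : Ioo 0 d ≤ᵐ[volume] ({m} : Set ℝ) := by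
      rw [Filter.EventuallyEq, ae_restrict_iff' measurableSet_Ioo] at hz
      filter_upwards [hz] with x hx hx'
      exact sub_eq_zero.1 (hx hx')
    have := measure_mono_ae h1
    simp at this
    linarith

/-! ### Neumann solutions and the sign of the derivative -/

/-- `φ` solves `-(h φ')' = μ h φ` on `(0, d)` with Neumann boundary conditions, and `g = φ'`. -/
structure IsNeumannSolution (d μ : ℝ) (h φ g : ℝ → ℝ) : Prop where
  cont : ContinuousOn φ (Icc 0 d)
  cont_deriv : ContinuousOn g (Icc 0 d)
  hasDerivAt : ∀ x ∈ Ioo 0 d, HasDerivAt φ (g x) x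
  ode : ∀ x ∈ Ioo 0 d, HasDerivAt (fun t => h t * g t) (-(μ * h x * φ x)) x
  deriv_left : g 0 = 0
  deriv_right : g d = 0

/-- The flux `h φ'`, extended by `0` outside of `(0, d)`. -/
noncomputable def flux (d : ℝ) (h g : ℝ → ℝ) : ℝ → ℝ := (Ioo 0 d).indicator fun x => h x * g x

lemma flux_of_mem {d x : ℝ} (hx : x ∈ Ioo 0 d) (h g : ℝ → ℝ) : flux d h g x = h x * g x :=
  indicator_of_mem hx _

lemma flux_zero (d : ℝ) (h g : ℝ → ℝ) : flux d h g 0 = 0 :=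
  indicator_of_notMem (by simp) _

lemma flux_right (d : ℝ) (h g : ℝ → ℝ) : flux d h g d = 0 :=
  indicator_of_notMem (by simp) _

lemma IsFirstNeumannEigenfunction.isNeumannSolution {d : ℝ} {h φ : ℝ → ℝ} (hd : 0 < d)
    (hφ : IsFirstNeumannEigenfunction d h φ) :
    IsNeumannSolution d (firstNeumannEigenvalue d h) h φ (derivWithin φ (Icc 0 d)) where
  cont := hφ.contDiffOn.continuousOn
  cont_deriv := hφ.contDiffOn.continuousOn_derivWithin (uniqueDiffOn_Icc hd) le_rfl
  hasDerivAt x hx := by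
    have h1 := (hφ.contDiffOn.differentiableOn one_ne_zero) x (Ioo_subset_Icc_self hx)
    exact h1.hasDerivWithinAt.hasDerivAt (Icc_mem_nhds hx.1 hx.2)
  ode := hφ.ode
  deriv_left := hφ.deriv_left
  deriv_right := hφ.deriv_right

namespace IsNeumannSolution

variable {p : ℕ} {d μ : ℝ} {h φ g : ℝ → ℝ}

/-- With the change of sign, an increasing solution stays increasing and one that is positive at `d`
becomes negative at `0`, so estimates at the left end yield those at the right end. -/
lemma reflect (hs : IsNeumannSolution d μ h φ g) :
    IsNeumannSolution d μ (fun x => h (d - x)) (fun x => -φ (d - x)) (fun x => g (d - x)) := by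
  have hm : ∀ x ∈ Ioo 0 d, d - x ∈ Ioo 0 d := fun x hx => ⟨by linarith [hx.2], by linarith [hx.1]⟩
  have hm' : MapsTo (fun x => d - x) (Icc 0 d) (Icc 0 d) :=
    fun x hx => ⟨by linarith [hx.2], by linarith [hx.1]⟩
  have hc : ContinuousOn (fun x : ℝ => d - x) (Icc 0 d) := by fun_prop
  have hder : ∀ x : ℝ, HasDerivAt (fun x => d - x) (-1) x := fun x => by
    simpa using (hasDerivAt_id x).const_sub d
  refine ⟨(hs.cont.comp hc hm').neg, hs.cont_deriv.comp hc hm', fun x hx => ?_, fun x hx => ?_,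
    by simpa using hs.deriv_right, by simpa using hs.deriv_left⟩
  · have := ((hs.hasDerivAt _ (hm x hx)).comp x (hder x)).fun_neg
    simpa [Function.comp_def] using this
  · have := (hs.ode _ (hm x hx)).comp x (hder x)
    simpa [Function.comp_def] using this

lemma hasDerivAt_flux (hs : IsNeumannSolution d μ h φ g) {x : ℝ} (hx : x ∈ Ioo 0 d) :
    HasDerivAt (flux d h g) (-(μ * h x * φ x)) x := by
  refine (hs.ode x hx).congr_of_eventuallyEq ?_
  filter_upwards [isOpen_Ioo.mem_nhds hx] with t ht using flux_of_mem ht h g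

/-- At the ends the values of `h` are arbitrary, but inside `h` is bounded by `2 ^ p * h (d / 2)`
and `g` tends to `0`, so the extension by zero is continuous. -/
lemma continuousOn_flux (hs : IsNeumannSolution d μ h φ g) (hw : IsConeWeight p d h) :
    ContinuousOn (flux d h g) (Icc 0 d) := by
  have hbd : ∀ x, |flux d h g x| ≤ 2 ^ p * |h (d / 2)| * |g x| := fun x => by
    by_cases hx : x ∈ Ioo 0 d
    · rw [flux_of_mem hx, abs_mul, abs_of_pos (hw.pos x hx)]
      refine mul_le_mul_of_nonneg_right ((hw.le_mid hx).trans ?_) (abs_nonneg _)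
      exact mul_le_mul_of_nonneg_left (le_abs_self _) (by positivity)
    · rw [flux, indicator_of_notMem hx, abs_zero]; positivity
  have hend : ∀ x ∈ Icc 0 d, g x = 0 → flux d h g x = 0 →
      ContinuousWithinAt (flux d h g) (Icc 0 d) x := by
    intro x hx hg hf
    rw [ContinuousWithinAt, hf]
    refine squeeze_zero_norm hbd ?_
    have := ((hs.cont_deriv x hx).abs.const_mul (2 ^ p * |h (d / 2)|)).tendsto
    simpa [hg] using this
  intro x hx
  rcases hx.1.eq_or_lt with rfl | h0
  · exact hend _ hx hs.deriv_left (flux_zero _ _ _)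
  rcases hx.2.eq_or_lt with rfl | h1
  · exact hend _ hx hs.deriv_right (flux_right _ _ _)
  exact (hs.hasDerivAt_flux ⟨h0, h1⟩).continuousAt.continuousWithinAt

/-- The mean value theorem for the flux. -/
lemma exists_flux_sub (hs : IsNeumannSolution d μ h φ g) (hw : IsConeWeight p d h) {a b : ℝ}
    (ha : 0 ≤ a) (hab : a < b) (hb : b ≤ d) :
    ∃ c ∈ Ioo a b, flux d h g b - flux d h g a = -(μ * h c * φ c) * (b - a) := by
  obtain ⟨c, hc, h1⟩ := exists_hasDerivAt_eq_slope (flux d h g) (fun x => -(μ * h x * φ x)) hab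
    ((hs.continuousOn_flux hw).mono (Icc_subset_Icc ha hb))
    fun x hx => hs.hasDerivAt_flux ⟨ha.trans_lt hx.1, hx.2.trans_le hb⟩
  exact ⟨c, hc, by rw [h1, div_mul_cancel₀ _ (sub_pos.2 hab).ne']⟩

lemma exists_sub (hs : IsNeumannSolution d μ h φ g) {a b : ℝ}
    (ha : 0 ≤ a) (hab : a < b) (hb : b ≤ d) : ∃ c ∈ Ioo a b, φ b - φ a = g c * (b - a) := by
  obtain ⟨c, hc, h1⟩ := exists_hasDerivAt_eq_slope φ g hab
    (hs.cont.mono (Icc_subset_Icc ha hb))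
    fun x hx => hs.hasDerivAt x ⟨ha.trans_lt hx.1, hx.2.trans_le hb⟩
  exact ⟨c, hc, by rw [h1, div_mul_cancel₀ _ (sub_pos.2 hab).ne']⟩

lemma flux_pos (hs : IsNeumannSolution d μ h φ g) (hw : IsConeWeight p d h) (hμ : 0 < μ) {b : ℝ}
    (hb0 : 0 < b) (hb : b ≤ d) (hneg : ∀ x ∈ Ioo 0 b, φ x < 0) : 0 < flux d h g b := by
  obtain ⟨c, hc, h1⟩ := hs.exists_flux_sub hw le_rfl hb0 hb
  rw [flux_zero] at h1
  have h2 := hw.pos c ⟨hc.1, hc.2.trans_le hb⟩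
  have h3 := hneg c hc
  nlinarith [mul_pos (mul_pos hμ h2) (mul_pos (neg_pos.2 h3) hb0)]

/-- If `φ b ≤ 0`, then `φ`, increasing up to `b`, is negative on `(0, b)`, which forces a positive
flux at `b`. -/
lemma pos_of_flux_eq_zero (hs : IsNeumannSolution d μ h φ g) (hw : IsConeWeight p d h)
    (hμ : 0 < μ) {b : ℝ} (hb0 : 0 < b) (hb : b ≤ d) (hg : ∀ x ∈ Ioo 0 b, 0 < g x)
    (hz : flux d h g b = 0) : 0 < φ b := by
  by_contra! hle
  refine (hs.flux_pos hw hμ hb0 hb fun x hx => ?_).ne' hz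
  obtain ⟨c, hc, h1⟩ := hs.exists_sub hx.1.le hx.2 hb
  have := mul_pos (hg c ⟨hx.1.trans hc.1, hc.2⟩) (sub_pos.2 hx.2)
  linarith

/-- Integral identities on an initial interval at whose end the flux vanishes. -/
lemma integral_eq_of_flux_eq_zero (hs : IsNeumannSolution d μ h φ g) (hw : IsConeWeight p d h)
    (hμ : μ ≠ 0) {b : ℝ} (hb0 : 0 < b) (hb : b ≤ d) (hz : flux d h g b = 0) :
    ∫ x in Ioc 0 b, h x * φ x = 0 ∧
      ∫ x in Ioc 0 b, h x * g x ^ 2 = μ * ∫ x in Ioc 0 b, h x * φ x ^ 2 := by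
  have hd : 0 < d := hb0.trans_le hb
  have hII : ∀ F : ℝ → ℝ, ContinuousOn F (Icc 0 d) →
      IntervalIntegrable (fun x => h x * F x) volume 0 b := fun F hF => by
    rw [intervalIntegrable_iff_integrableOn_Ioo_of_le hb0.le]
    exact (hw.integrableOn_mul_continuousOn hF).mono_set (Ioo_subset_Ioo_right hb)
  have hwc : ContinuousOn (flux d h g) (Icc 0 b) :=
    (hs.continuousOn_flux hw).mono (Icc_subset_Icc_right hb)
  have hφc : ContinuousOn φ (Icc 0 b) := hs.cont.mono (Icc_subset_Icc_right hb)
  have hwd : ∀ x ∈ Ioo 0 b, HasDerivAt (flux d h g) (-(μ * (h x * φ x))) x := fun x hx => by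
    rw [← mul_assoc]; exact hs.hasDerivAt_flux ⟨hx.1, hx.2.trans_le hb⟩
  have hφd : ∀ x ∈ Ioo 0 b, HasDerivAt φ (g x) x := fun x hx =>
    hs.hasDerivAt x ⟨hx.1, hx.2.trans_le hb⟩
  have hi1 : IntervalIntegrable (fun x => -(μ * (h x * φ x))) volume 0 b :=
    ((hII φ hs.cont).const_mul μ).neg
  constructor
  · have := intervalIntegral.integral_eq_sub_of_hasDerivAt_of_le hb0.le hwc hwd hi1
    rw [hz, flux_zero, intervalIntegral.integral_neg, intervalIntegral.integral_const_mul,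
      intervalIntegral.integral_of_le hb0.le] at this
    simpa [hμ] using this
  · have := intervalIntegral.integral_deriv_mul_eq_sub_of_hasDerivAt (u := flux d h g) (v := φ)
      (by rwa [uIcc_of_le hb0.le]) (by rwa [uIcc_of_le hb0.le])
      (by rwa [min_eq_left hb0.le, max_eq_right hb0.le])
      (by rwa [min_eq_left hb0.le, max_eq_right hb0.le]) hi1
      ((hs.cont_deriv.mono (Icc_subset_Icc_right hb)).intervalIntegrable_of_Icc hb0.le)
    rw [hz, flux_zero, zero_mul, zero_mul, sub_zero, intervalIntegral.integral_of_le hb0.le,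
      integral_Ioc_eq_integral_Ioo] at this
    rw [integral_Ioc_eq_integral_Ioo, integral_Ioc_eq_integral_Ioo]
    have e : ∫ x in Ioo 0 b, (-(μ * (h x * φ x)) * φ x + flux d h g x * g x) =
        ∫ x in Ioo 0 b, (h x * g x ^ 2 - μ * (h x * φ x ^ 2)) := by
      refine setIntegral_congr_fun measurableSet_Ioo fun x hx => ?_
      rw [flux_of_mem ⟨hx.1, hx.2.trans_le hb⟩]; ring
    rw [e, integral_sub, integral_const_mul] at this
    · linarith
    · exact (hw.integrableOn_mul_continuousOn (hs.cont_deriv.pow 2)).mono_set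
        (Ioo_subset_Ioo_right hb)
    · exact ((hw.integrableOn_mul_continuousOn (hs.cont.pow 2)).mono_set
        (Ioo_subset_Ioo_right hb)).const_mul μ

/-- Freezing `φ` after a critical point `b` keeps it `C¹`, which makes it an admissible test
function. -/
lemma hasDerivAt_comp_min (hs : IsNeumannSolution d μ h φ g) {b : ℝ} (hb : b ∈ Ioo 0 d)
    (hgb : g b = 0) {x : ℝ} (hx : x ∈ Ioo 0 d) :
    HasDerivAt (fun t => φ (min t b)) (g (min x b)) x := by
  rcases lt_trichotomy x b with hlt | rfl | hgt
  · rw [min_eq_left hlt.le]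
    refine (hs.hasDerivAt x hx).congr_of_eventuallyEq ?_
    filter_upwards [Iio_mem_nhds hlt] with t ht
    rw [min_eq_left (le_of_lt ht)]
  · rw [min_self, hgb]
    have h1 : HasDerivWithinAt (fun t => φ (min t x)) 0 (Iic x) x := by
      have := (hs.hasDerivAt x hx).hasDerivWithinAt (s := Iic x)
      rw [hgb] at this
      exact this.congr (fun t ht => by rw [min_eq_left ht]) (by rw [min_self])
    have h2 : HasDerivWithinAt (fun t => φ (min t x)) 0 (Ici x) x :=
      (hasDerivWithinAt_const x (Ici x) (φ x)).congr (fun t ht => by rw [min_eq_right ht])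
        (by rw [min_self])
    have := h1.union h2
    rwa [Iic_union_Ici, hasDerivWithinAt_univ] at this
  · rw [min_eq_right hgt.le, hgb]
    refine (hasDerivAt_const x (φ b)).congr_of_eventuallyEq ?_
    filter_upwards [Ioi_mem_nhds hgt] with t ht
    rw [min_eq_right (le_of_lt ht)]

/-- The flux of a first eigenfunction cannot vanish in the interior. -/
lemma not_flux_eq_zero (hs : IsNeumannSolution d (firstNeumannEigenvalue d h) h φ g)
    (hw : IsConeWeight p d h) (hμ : 0 < firstNeumannEigenvalue d h) {b : ℝ} (hb : b ∈ Ioo 0 d)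
    (hpos : 0 < φ b) : flux d h g b ≠ 0 := by
  intro hz
  have hd : 0 < d := hb.1.trans hb.2
  have hgb : g b = 0 := by
    rw [flux_of_mem hb] at hz
    exact (mul_eq_zero.1 hz).resolve_left (hw.pos b hb).ne'
  obtain ⟨hI1, hI2⟩ := hs.integral_eq_of_flux_eq_zero hw hμ.ne' hb.1 hb.2.le hz
  have hmin : MapsTo (fun t => min t b) (Icc 0 d) (Icc 0 d) := fun t ht =>
    ⟨le_min ht.1 hb.1.le, (min_le_left _ _).trans ht.2⟩
  have hminc : ContinuousOn (fun t : ℝ => min t b) (Icc 0 d) := by fun_prop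
  have hfc : ContinuousOn (fun t => φ (min t b)) (Icc 0 d) := hs.cont.comp hminc hmin
  have hgc : ContinuousOn (fun t => g (min t b)) (Icc 0 d) := hs.cont_deriv.comp hminc hmin
  have hsplit : ∀ F : ℝ → ℝ, IntegrableOn F (Ioo 0 d) →
      ∫ x in Ioo 0 d, F x = (∫ x in Ioc 0 b, F x) + ∫ x in Ioo b d, F x := fun F hF => by
    rw [← Ioc_union_Ioo_eq_Ioo hb.1.le hb.2, setIntegral_union _ measurableSet_Ioo
      (hF.mono_set (Ioc_subset_Ioo_right hb.2)) (hF.mono_set (Ioo_subset_Ioo_left hb.1.le))]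
    exact disjoint_left.2 fun x hx hx' => not_lt.2 hx.2 hx'.1
  have hint : ∀ F : ℝ → ℝ, ContinuousOn F (Icc 0 d) →
      ∫ x in Ioo 0 d, h x * F (min x b) =
        (∫ x in Ioc 0 b, h x * F x) + F b * ∫ x in Ioo b d, h x := fun F hF => by
    have hFc : ContinuousOn (fun t => F (min t b)) (Icc 0 d) := hF.comp hminc hmin
    rw [hsplit _ (hw.integrableOn_mul_continuousOn hFc), ← integral_const_mul]
    congr 1
    · refine setIntegral_congr_fun measurableSet_Ioc fun x hx => ?_
      rw [min_eq_left hx.2]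
    · refine setIntegral_congr_fun measurableSet_Ioo fun x hx => ?_
      rw [min_eq_right hx.1.le, mul_comm]
  have hH := hsplit h hw.integrableOn
  have hpart : ∀ s ⊆ Ioo 0 d, MeasurableSet s → volume s ≠ 0 → 0 < ∫ x in s, h x := by
    intro s hsub hsm hs0
    rw [setIntegral_pos_iff_support_of_nonneg_ae]
    · have : Function.support h ∩ s = s := inter_eq_right.2 fun x hx => (hw.pos x (hsub hx)).ne'
      rw [this]
      exact pos_iff_ne_zero.2 hs0
    · exact (ae_restrict_iff' hsm).2 (ae_of_all _ fun x hx => (hw.pos x (hsub hx)).le)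
    · exact hw.integrableOn.mono_set hsub
  have hH1 := hpart _ (Ioc_subset_Ioo_right hb.2) measurableSet_Ioc (by simp [hb.1])
  have hH2 := hpart _ (Ioo_subset_Ioo_left hb.1.le) measurableSet_Ioo (by simp [hb.2])
  have hHpos := hw.integral_pos hd
  set H := ∫ x in Ioo 0 d, h x
  set H1 := ∫ x in Ioc 0 b, h x
  set H2 := ∫ x in Ioo b d, h x
  set S := ∫ x in Ioc 0 b, h x * φ x ^ 2
  have hmean : ∫ x in Ioo 0 d, h x * φ (min x b) = φ b * H2 := by
    rw [hint φ hs.cont, hI1, zero_add]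
  have hsq : ∫ x in Ioo 0 d, h x * φ (min x b) ^ 2 = S + φ b ^ 2 * H2 :=
    hint (fun t => φ t ^ 2) (hs.cont.pow 2)
  have hgsq : ∫ x in Ioo 0 d, h x * g (min x b) ^ 2 = firstNeumannEigenvalue d h * S := by
    rw [hint (fun t => g t ^ 2) (hs.cont_deriv.pow 2), hI2, hgb]; ring
  have key := hw.firstNeumannEigenvalue_mul_le hd hfc hgc
    (fun x hx => hs.hasDerivAt_comp_min hb hgb hx) (m := φ b * H2 / H)
    (by rw [hmean, div_mul_cancel₀ _ hHpos.ne'])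
  rw [hw.integral_mul_sub_sq (isSobolev_of_hasDerivAt hd hfc hgc
    fun x hx => hs.hasDerivAt_comp_min hb hgb hx).memLp, hmean, hsq, hgsq] at key
  have key' := le_of_mul_le_mul_left key hμ
  -- The energy is `μ S`, while the variance is `S` plus this quantity. As it is positive, the
  -- quotient falls below `μ`.
  have e : φ b ^ 2 * H2 - 2 * (φ b * H2 / H) * (φ b * H2) + (φ b * H2 / H) ^ 2 * H =
      φ b ^ 2 * H2 * H1 / H := by
    field_simp
    rw [hH]; ring
  have : 0 < φ b ^ 2 * H2 * H1 / H := by positivity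
  linarith

/-- A first eigenfunction that starts with a negative value is strictly increasing, and its
final value is positive. -/
lemma deriv_pos (hs : IsNeumannSolution d (firstNeumannEigenvalue d h) h φ g)
    (hw : IsConeWeight p d h) (hd : 0 < d) (h0 : φ 0 < 0) :
    (∀ x ∈ Ioo 0 d, 0 < g x) ∧ 0 < φ d := by
  have hμ : 0 < firstNeumannEigenvalue d h :=
    lt_of_lt_of_le (by positivity) (hw.le_firstNeumannEigenvalue hd)
  have hgpos : ∀ x ∈ Ioo 0 d, 0 < flux d h g x → 0 < g x := fun x hx hfx => by
    rw [flux_of_mem hx] at hfx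
    exact (pos_iff_pos_of_mul_pos hfx).1 (hw.pos x hx)
  obtain ⟨ε, hε, hεd, hneg⟩ : ∃ ε > 0, ε < d ∧ ∀ x ∈ Ioo 0 ε, φ x < 0 := by
    have h1 := (hs.cont 0 ⟨le_rfl, hd.le⟩).eventually_lt continuousWithinAt_const h0
    rw [nhdsWithin_Icc_eq_nhdsGE hd] at h1
    obtain ⟨u, hu, hu'⟩ := mem_nhdsGE_iff_exists_Ico_subset.1 h1
    refine ⟨min u (d / 2), lt_min hu (by linarith), (min_le_right _ _).trans_lt (by linarith),
      fun x hx => hu' ⟨hx.1.le, hx.2.trans_le (min_le_left _ _)⟩⟩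
  have hall : ∀ x ∈ Ioo 0 d, 0 < flux d h g x := by
    by_contra! hcon
    obtain ⟨y, hy, hy0⟩ := hcon
    have hfl : ∀ x ∈ Ioc 0 ε, 0 < flux d h g x := fun x hx =>
      hs.flux_pos hw hμ hx.1 (hx.2.trans hεd.le) fun t ht => hneg t ⟨ht.1, ht.2.trans_le hx.2⟩
    have hεy : ε < y := by
      by_contra! hle
      exact (hfl y ⟨hy.1, hle⟩).not_ge hy0
    have hcε : ContinuousOn (flux d h g) (Icc ε y) :=
      (hs.continuousOn_flux hw).mono (Icc_subset_Icc hε.le hy.2.le)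
    -- Compactness yields the first point `b` at which the flux is nonpositive; by continuity it is
    -- zero there.
    have hcpt : IsCompact (Icc ε y ∩ flux d h g ⁻¹' Iic 0) :=
      isCompact_Icc.of_isClosed_subset (hcε.preimage_isClosed_of_isClosed isClosed_Icc isClosed_Iic)
        inter_subset_left
    obtain ⟨b, ⟨hb, hb0⟩, hmin⟩ := hcpt.exists_isLeast ⟨y, ⟨hεy.le, le_rfl⟩, hy0⟩
    have hbpos : 0 < b := hε.trans_le hb.1
    have hbd : b < d := hb.2.trans_lt hy.2
    have hbefore : ∀ x ∈ Ioo 0 b, 0 < flux d h g x := fun x hx => by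
      rcases le_total x ε with hle | hle
      · exact hfl x ⟨hx.1, hle⟩
      · by_contra! hx0
        exact (hmin ⟨⟨hle, hx.2.le.trans hb.2⟩, hx0⟩).not_gt hx.2
    have hbz : flux d h g b = 0 := by
      refine le_antisymm hb0 ?_
      have hc := (hs.hasDerivAt_flux (x := b) ⟨hbpos, hbd⟩).continuousAt
      refine ge_of_tendsto (hc.tendsto.mono_left nhdsWithin_le_nhds : Filter.Tendsto _
        (nhdsWithin b (Iio b)) _) ?_
      filter_upwards [Ioo_mem_nhdsLT hbpos] with x hx using (hbefore x hx).le
    refine hs.not_flux_eq_zero hw hμ ⟨hbpos, hbd⟩ ?_ hbz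
    exact hs.pos_of_flux_eq_zero hw hμ hbpos hbd.le
      (fun x hx => hgpos x ⟨hx.1, hx.2.trans hbd⟩ (hbefore x hx)) hbz
  have hg : ∀ x ∈ Ioo 0 d, 0 < g x := fun x hx => hgpos x hx (hall x hx)
  exact ⟨hg, hs.pos_of_flux_eq_zero hw hμ hd le_rfl hg (flux_right _ _ _)⟩

end IsNeumannSolution

/-! ### Quantitative estimates from the flux -/

namespace IsNeumannSolution

variable {p : ℕ} {d μ A B K : ℝ} {h φ g : ℝ → ℝ}

lemma monotoneOn (hs : IsNeumannSolution d μ h φ g) (hg : ∀ x ∈ Ioo 0 d, 0 < g x) :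
    MonotoneOn φ (Icc 0 d) := by
  intro x hx y hy hxy
  rcases hxy.eq_or_lt with rfl | hlt
  · exact le_rfl
  obtain ⟨c, hc, h1⟩ := hs.exists_sub hx.1 hlt hy.2
  have := mul_pos (hg c ⟨hx.1.trans_lt hc.1, hc.2.trans_le hy.2⟩) (sub_pos.2 hlt)
  linarith

/-- The flux at `x` is `μ x h(c) (-φ(c))` for some `c < x`; here `-φ(c) ≤ A` by monotonicity and `h
c ≤ K ^ p * h x` by the cone condition at `d`. -/
lemma deriv_le (hs : IsNeumannSolution d μ h φ g) (hw : IsConeWeight p d h) (hμ : 0 < μ)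
    (hg : ∀ x ∈ Ioo 0 d, 0 < g x) (hA : φ 0 = -A) (hA0 : 0 < A) {x : ℝ} (hx : x ∈ Ioo 0 d)
    (hK : d ≤ K * (d - x)) : g x ≤ μ * A * K ^ p * x := by
  obtain ⟨c, hc, h1⟩ := hs.exists_flux_sub hw le_rfl hx.1 hx.2.le
  have hcd : c ∈ Ioo 0 d := ⟨hc.1, hc.2.trans hx.2⟩
  have h2 : -A ≤ φ c := hA ▸ hs.monotoneOn hg ⟨le_rfl, (hx.1.trans hx.2).le⟩
    (Ioo_subset_Icc_self hcd) hc.1.le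
  have h3 : h c ≤ K ^ p * h x := hw.le_of_right hcd hx hc.2.le (by linarith [hc.1])
  rw [flux_zero, sub_zero, sub_zero, flux_of_mem hx] at h1
  refine le_of_mul_le_mul_left ?_ (hw.pos x hx)
  calc h x * g x = μ * x * h c * (-φ c) := by rw [h1]; ring
    _ ≤ μ * x * h c * A := by
        have := mul_pos (mul_pos hμ hx.1) (hw.pos c hcd)
        exact mul_le_mul_of_nonneg_left (by linarith) this.le
    _ = μ * x * A * h c := by ring
    _ ≤ μ * x * A * (K ^ p * h x) :=
        mul_le_mul_of_nonneg_left h3 (mul_pos (mul_pos hμ hx.1) hA0).le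
    _ = _ := by ring

lemma le_quadratic (hs : IsNeumannSolution d μ h φ g) (hw : IsConeWeight p d h) (hμ : 0 < μ)
    (hg : ∀ x ∈ Ioo 0 d, 0 < g x) (hA : φ 0 = -A) (hA0 : 0 < A) {x : ℝ} (hx : x ∈ Ioo 0 d)
    (hK : d ≤ K * (d - x)) : φ x ≤ -A + μ * A * K ^ p * x ^ 2 := by
  obtain ⟨c, hc, h1⟩ := hs.exists_sub le_rfl hx.1 hx.2.le
  have hK0 : 0 < K := by
    by_contra! hle
    nlinarith [hx.1, hx.2]
  have h2 := hs.deriv_le hw hμ hg hA hA0 (x := c) ⟨hc.1, hc.2.trans hx.2⟩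
    (hK.trans (mul_le_mul_of_nonneg_left (by linarith [hc.2]) hK0.le))
  have h3 : μ * A * K ^ p * c ≤ μ * A * K ^ p * x :=
    mul_le_mul_of_nonneg_left hc.2.le (by positivity)
  nlinarith [mul_le_mul_of_nonneg_right (h2.trans h3) hx.1.le]

lemma le_neg_half (hs : IsNeumannSolution d μ h φ g) (hw : IsConeWeight p d h) (hμ : 0 < μ)
    (hg : ∀ x ∈ Ioo 0 d, 0 < g x) (hA : φ 0 = -A) (hA0 : 0 < A) (hp : 1 ≤ p) (hd : 1 ≤ d)
    (hμ' : μ ≤ 96 * 4 ^ p) {x : ℝ} (hx0 : 0 ≤ x) (hx : x ≤ 1 / 10 ^ (p + 1)) : φ x ≤ -A / 2 := by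
  rcases hx0.eq_or_lt with rfl | hx0
  · rw [hA]; linarith
  have hδ : (1 : ℝ) / 10 ^ (p + 1) ≤ 1 / 10 := by
    rw [div_le_div_iff₀ (by positivity) (by norm_num), pow_succ]
    nlinarith [one_le_pow₀ (M₀ := ℝ) (a := 10) (by norm_num) (n := p)]
  have h1 := hs.le_quadratic hw hμ hg hA hA0 (K := 2) (x := x) ⟨hx0, by linarith⟩ (by linarith)
  have h2 : x ^ 2 ≤ 1 / 100 ^ (p + 1) := by
    calc x ^ 2 ≤ (1 / 10 ^ (p + 1)) ^ 2 := pow_le_pow_left₀ hx0.le hx 2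
      _ = 1 / 100 ^ (p + 1) := by
        rw [div_pow, one_pow, ← pow_mul, mul_comm (p + 1), pow_mul]; norm_num
  have h3 : 96 * 4 ^ p * 2 ^ p * (1 / 100 ^ (p + 1)) ≤ (1 / 2 : ℝ) := by
    -- The case `p = 0` has to be excluded, since `96 / 100` exceeds `1 / 2`; from `p = 1` on, the
    -- factor `8 / 100` per step gives room to spare.
    obtain ⟨q, rfl⟩ : ∃ q, p = q + 1 := ⟨p - 1, by omega⟩
    rw [mul_assoc 96, ← mul_pow, mul_one_div, div_le_div_iff₀ (by positivity) (by norm_num)]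
    have : ((4 : ℝ) * 2) ^ q ≤ 100 ^ q := pow_le_pow_left₀ (by norm_num) (by norm_num) q
    have h0 : (0 : ℝ) < 100 ^ q := by positivity
    simp only [pow_succ]
    linarith
  have h4 : μ * 2 ^ p * x ^ 2 ≤ 1 / 2 :=
    (mul_le_mul (mul_le_mul_of_nonneg_right hμ' (by positivity)) h2 (sq_nonneg _)
      (by positivity)).trans h3
  nlinarith [mul_le_mul_of_nonneg_left h4 hA0.le]

/-- Only the growth of the flux on `[x / 2, x]` is kept: there `x ≤ 2 c`, so `h c` is comparable to
`h x`, and `-φ ≥ A / 2`. -/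
lemma le_deriv (hs : IsNeumannSolution d μ h φ g) (hw : IsConeWeight p d h) (hμ : 0 < μ)
    (hg : ∀ x ∈ Ioo 0 d, 0 < g x) (hA0 : 0 < A) {x : ℝ} (hx : x ∈ Ioo 0 d)
    (hφ : ∀ t ∈ Ioo 0 x, φ t ≤ -A / 2) : μ * A / (4 * 2 ^ p) * x ≤ g x := by
  have hx2 : x / 2 ∈ Ioo 0 d := ⟨by linarith [hx.1], by linarith [hx.1, hx.2]⟩
  obtain ⟨c, hc, h1⟩ := hs.exists_flux_sub hw hx2.1.le (by linarith [hx.1] : x / 2 < x) hx.2.le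
  have hcd : c ∈ Ioo 0 d := ⟨hx2.1.trans hc.1, hc.2.trans hx.2⟩
  have h2 := hφ c ⟨hcd.1, hc.2⟩
  have h3 : h x ≤ 2 ^ p * h c := hw.le_of_left hcd hx hc.2.le (by linarith [hc.1])
  rw [flux_of_mem hx, flux_of_mem hx2] at h1
  have h4 := mul_pos (hw.pos _ hx2) (hg _ hx2)
  have h5 : μ * h c * (A / 2) * (x / 2) ≤ h x * g x := by
    have : μ * h c * (A / 2) ≤ μ * h c * (-φ c) :=
      mul_le_mul_of_nonneg_left (by linarith) (mul_pos hμ (hw.pos c hcd)).le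
    have := mul_le_mul_of_nonneg_right this (by linarith [hx.1] : 0 ≤ x / 2)
    nlinarith
  refine le_of_mul_le_mul_left (le_trans ?_ h5) (hw.pos x hx)
  calc h x * (μ * A / (4 * 2 ^ p) * x) = μ * A * x / 4 * (h x / 2 ^ p) := by field_simp
    _ ≤ μ * A * x / 4 * h c := by
        refine mul_le_mul_of_nonneg_left ?_ ?_
        · rw [div_le_iff₀ (by positivity)]; linarith
        · have := mul_pos (mul_pos hμ hA0) hx.1; linarith
    _ = _ := by ring

/-- The amplitudes of a solution at the two ends are comparable. -/
lemma right_le_mul_left (hs : IsNeumannSolution d μ h φ g) (hw : IsConeWeight p d h) (hμ : 0 < μ)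
    (hg : ∀ x ∈ Ioo 0 d, 0 < g x) (hA : φ 0 = -A) (hA0 : 0 < A) (hB : φ d = B) (hB0 : 0 < B)
    (hp : 1 ≤ p) (hd : 1 ≤ d) (hd2 : d ≤ 2) (hμ' : μ ≤ 96 * 4 ^ p) :
    B ≤ 768 * 4 ^ p * (2 * 10 ^ (p + 1)) ^ p * A := by
  have hg' : ∀ x ∈ Ioo 0 d, 0 < g (d - x) := fun x hx =>
    hg _ ⟨by linarith [hx.2], by linarith [hx.1]⟩
  have hδ0 : (0 : ℝ) < 1 / 10 ^ (p + 1) := by positivity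
  have hδ : (1 : ℝ) / 10 ^ (p + 1) ≤ 1 / 10 := by
    rw [div_le_div_iff₀ (by positivity) (by norm_num), pow_succ]
    nlinarith [one_le_pow₀ (M₀ := ℝ) (a := 10) (by norm_num) (n := p)]
  have h1 := hs.reflect.le_neg_half hw.reflect hμ hg' (A := B) (by simp [hB]) hB0 hp hd hμ'
    hδ0.le le_rfl
  have hx : d - 1 / 10 ^ (p + 1) ∈ Ioo 0 d := ⟨by linarith, by linarith⟩
  -- Let `δ = 1 / 10 ^ (p + 1)`. By reflection `φ (d - δ) ≥ B / 2`, while the quadratic bound from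
  -- the left end controls `φ (d - δ)` by `A`. The choice of `K` makes `K * δ = 2 ≥ d`, and `768 = 2
  -- * 96 * 4`.
  have h2 := hs.le_quadratic hw hμ hg hA hA0 (K := 2 * 10 ^ (p + 1)) hx (by
    have : (2 * 10 ^ (p + 1) : ℝ) * (d - (d - 1 / 10 ^ (p + 1))) = 2 := by field_simp; ring
    linarith)
  have h3 : (d - 1 / 10 ^ (p + 1)) ^ 2 ≤ 4 := by nlinarith [hx.1]
  have h4 : μ * A * (2 * 10 ^ (p + 1)) ^ p * (d - 1 / 10 ^ (p + 1)) ^ 2 ≤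
      96 * 4 ^ p * A * (2 * 10 ^ (p + 1)) ^ p * 4 := by gcongr
  linarith

end IsNeumannSolution

lemma IsFirstNeumannEigenfunction.estimates {p : ℕ} {d : ℝ} {h φ : ℝ → ℝ}
    (hφ : IsFirstNeumannEigenfunction d h φ) (hw : IsConeWeight p d h) (hp : 1 ≤ p) (hd : 1 ≤ d)
    (hd2 : d ≤ 2) :
    Estimates (p + 1) (96 * 8 ^ p * (768 * 4 ^ p * (2 * 10 ^ (p + 1)) ^ p)) d φ := by
  have hd0 : 0 < d := by linarith
  have hs := hφ.isNeumannSolution hd0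
  have hA : φ 0 = -1 := hφ.map_zero
  obtain ⟨hg, hB0⟩ := hs.deriv_pos hw hd0 (by rw [hA]; norm_num)
  set μ := firstNeumannEigenvalue d h with hμdef
  set g := derivWithin φ (Icc 0 d) with hgdef
  set B := φ d with hB
  set C₀ : ℝ := 768 * 4 ^ p * (2 * 10 ^ (p + 1)) ^ p with hC₀
  have hμlow : 1 / (4 * 2 ^ p) ≤ μ := by
    refine le_trans ?_ (hw.le_firstNeumannEigenvalue hd0)
    have : d ^ 2 ≤ 4 := by nlinarith
    gcongr
  have hμ : 0 < μ := lt_of_lt_of_le (by positivity) hμlow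
  have hμ' : μ ≤ 96 * 4 ^ p := by
    have h1 := hw.firstNeumannEigenvalue_le hd0
    have h2 : (1 : ℝ) ≤ d ^ 2 := by nlinarith
    nlinarith
  have hs' := hs.reflect
  have hw' := hw.reflect
  have hg' : ∀ x ∈ Ioo 0 d, 0 < g (d - x) := fun x hx =>
    hg _ ⟨by linarith [hx.2], by linarith [hx.1]⟩
  have hA' : -φ (d - 0) = -B := by simp [hB]
  have hB' : -φ (d - d) = 1 := by simp [hA]
  have hBC : B ≤ C₀ := by
    simpa using hs.right_le_mul_left hw hμ hg hA one_pos rfl hB0 hp hd hd2 hμ'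
  have hCB : 1 ≤ C₀ * B := hs'.right_le_mul_left hw' hμ hg' hA' hB0 hB' one_pos hp hd hd2 hμ'
  have hC1 : 1 ≤ C₀ := by
    have h1 : (1 : ℝ) ≤ 4 ^ p := one_le_pow₀ (by norm_num)
    have h2 : (1 : ℝ) ≤ (2 * 10 ^ (p + 1)) ^ p :=
      one_le_pow₀ (by linarith [one_le_pow₀ (M₀ := ℝ) (a := 10) (by norm_num) (n := p + 1)])
    rw [hC₀]
    nlinarith
  have h8 : (1 : ℝ) ≤ 8 ^ p := one_le_pow₀ (by norm_num)
  have h84 : (8 : ℝ) ^ p = 4 ^ p * 2 ^ p := by rw [← mul_pow]; norm_num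
  have h8' : (8 : ℝ) ^ p = 2 ^ p * 2 ^ p * 2 ^ p := by rw [← mul_pow, ← mul_pow]; norm_num
  have h2 : (1 : ℝ) ≤ 2 ^ p := one_le_pow₀ (by norm_num)
  have hleft := fun x => hs.le_neg_half hw hμ hg hA one_pos hp hd hμ' (x := x)
  have hright := fun x => hs'.le_neg_half hw' hμ hg' hA' hB0 hp hd hμ' (x := x)
  -- Here `a` stands for the amplitude at either end, `1` or `B`. The bound on `μ` from below would
  -- allow `16 * 4 ^ p * C₀`; the larger constant also serves the upper estimate `hup`.
  have hCinv : ∀ a : ℝ, 1 ≤ C₀ * a → (96 * 8 ^ p * C₀)⁻¹ ≤ μ * a / (4 * 2 ^ p) := by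
    intro a ha
    have ha0 : 0 < a := by
      by_contra! hle
      nlinarith
    rw [inv_le_iff_one_le_mul₀ (by positivity)]
    calc (1 : ℝ) ≤ C₀ * a := ha
      _ ≤ 6 * 2 ^ p * (C₀ * a) := by nlinarith [mul_pos (zero_lt_one.trans_le hC1) ha0]
      _ = 1 / (4 * 2 ^ p) * a / (4 * 2 ^ p) * (96 * 8 ^ p * C₀) := by rw [h8']; field_simp; norm_num
      _ ≤ μ * a / (4 * 2 ^ p) * (96 * 8 ^ p * C₀) := by gcongr
  have hmono := hs.monotoneOn hg
  have hup : ∀ a : ℝ, 0 < a → a ≤ C₀ → μ * a * 2 ^ p ≤ 96 * 8 ^ p * C₀ := fun a ha haC => by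
    calc μ * a * 2 ^ p ≤ 96 * 4 ^ p * C₀ * 2 ^ p := by gcongr
      _ = _ := by rw [h84]; ring
  refine ⟨fun x hx hxδ => ?_, fun x hx hx0 => ?_, fun x hx => ?_, fun x hx => ?_, fun x hx => ?_⟩
  · rcases hx.1.eq_or_lt with rfl | hx0
    · simp [endDist, hd0.le, hφ.deriv_left]
    rcases hx.2.eq_or_lt with rfl | hxd
    · simp [endDist, hd0.le, hφ.deriv_right]
    rcases le_total x (d - x) with hle | hle
    · rw [endDist, min_eq_left hle] at hxδ ⊢
      have := hs.le_deriv hw hμ hg one_pos (x := x) ⟨hx0, hxd⟩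
        fun t ht => hleft t ht.1.le (ht.2.le.trans hxδ)
      exact (mul_le_mul_of_nonneg_right (hCinv 1 (by linarith)) hx0.le).trans this
    · rw [endDist, min_eq_right hle] at hxδ ⊢
      have := hs'.le_deriv hw' hμ hg' hB0 (x := d - x) ⟨by linarith, by linarith⟩
        fun t ht => hright t ht.1.le (ht.2.le.trans hxδ)
      rw [sub_sub_cancel] at this
      exact (mul_le_mul_of_nonneg_right (hCinv B hCB) (by linarith)).trans this
  · constructor
    · by_contra! hlt
      have := hleft x hx.1 hlt.le
      rw [hx0] at this
      linarith
    · by_contra! hlt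
      have := hright (d - x) (by linarith [hx.2]) (by linarith)
      rw [sub_sub_cancel, hx0] at this
      linarith
  · have h3 := hmono ⟨le_rfl, hd0.le⟩ hx hx.1
    have h4 := hmono hx ⟨hd0.le, le_rfl⟩ hx.2
    rw [hA] at h3
    have : C₀ ≤ 96 * 8 ^ p * C₀ := by nlinarith
    rw [abs_le]
    constructor <;> linarith
  · rcases hx.1.eq_or_lt with rfl | hx0
    · exact hs.deriv_left.ge
    rcases hx.2.eq_or_lt with rfl | hxd
    · exact hs.deriv_right.ge
    exact (hg x ⟨hx0, hxd⟩).le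
  · rcases hx.1.eq_or_lt with rfl | hx0
    · simp [endDist, hd0.le, hφ.deriv_left]
    rcases hx.2.eq_or_lt with rfl | hxd
    · simp [endDist, hd0.le, hφ.deriv_right]
    rcases le_total x (d - x) with hle | hle
    · rw [endDist, min_eq_left hle]
      have := hs.deriv_le hw hμ hg hA one_pos (x := x) (K := 2) ⟨hx0, hxd⟩ (by linarith)
      exact this.trans (mul_le_mul_of_nonneg_right (hup 1 one_pos hC1) hx0.le)
    · rw [endDist, min_eq_right hle]
      have := hs'.deriv_le hw' hμ hg' hA' hB0 (x := d - x) (K := 2)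
        ⟨by linarith, by linarith⟩ (by linarith)
      rw [sub_sub_cancel] at this
      exact this.trans (mul_le_mul_of_nonneg_right (hup B hB0 hBC) (by linarith))

/-! ### Cone condition from homotheties -/

lemma le_of_forall_mem_Ioo {a b : ℝ} (hab : a < b) {F G : ℝ → ℝ} (hF : Continuous F)
    (hG : Continuous G) (h : ∀ e ∈ Ioo a b, F e ≤ G e) : F a ≤ G a ∧ F b ≤ G b := by
  have : closure (Ioo a b) ⊆ {e | F e ≤ G e} := closure_minimal h (isClosed_le hF hG)
  rw [closure_Ioo hab.ne] at this
  exact ⟨this ⟨le_rfl, hab.le⟩, this ⟨hab.le, le_rfl⟩⟩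

/-- A positive weight is a cone weight if it dominates the homotheties of its values. -/
lemma IsConeWeight.of_homothety {p : ℕ} {d : ℝ} {h : ℝ → ℝ} (hpos : ∀ x ∈ Ioo 0 d, 0 < h x)
    (H : ∀ e ∈ Ioo 0 d, ∀ y ∈ Ioo 0 d, ∀ s ∈ Icc (0 : ℝ) 1,
      s ^ p * h y ≤ h ((1 - s) * e + s * y)) : IsConeWeight p d h := by
  -- The homothety with centre `e` and ratio `(x - e) / (y - e)` takes `y` to `x`. Letting `e` tend
  -- to `0` or to `d` gives the two halves of the cone condition; the limit is needed because
  -- nothing is known about `h` at the ends.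
  have key : ∀ e ∈ Ioo 0 d, ∀ x ∈ Ioo 0 d, ∀ y ∈ Ioo 0 d, 0 ≤ (x - e) / (y - e) →
      (x - e) / (y - e) ≤ 1 → y ≠ e → (x - e) ^ p / (y - e) ^ p * h y ≤ h x := by
    intro e he x hx y hy h0 h1 hne
    have := H e he y hy _ ⟨h0, h1⟩
    have hne' := sub_ne_zero.2 hne
    rwa [show (1 - (x - e) / (y - e)) * e + (x - e) / (y - e) * y = x by field_simp; ring,
      div_pow] at this
  refine ⟨hpos, fun x hx y hy hxy => ?_, fun x hx y hy hxy => ?_⟩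
  · have h1 := (le_of_forall_mem_Ioo hx.1 (F := fun e => h y * (x - e) ^ p)
      (G := fun e => h x * (y - e) ^ p) (by fun_prop) (by fun_prop) fun e he => ?_).1
    · simpa using h1
    · have hye : 0 < y - e := by linarith [he.2]
      have := key e ⟨he.1, he.2.trans hx.2⟩ x hx y hy (div_nonneg (by linarith [he.2]) hye.le)
        ((div_le_one hye).2 (by linarith)) (by linarith)
      rw [div_mul_eq_mul_div, div_le_iff₀ (pow_pos hye p)] at this
      linarith
  · have h1 := (le_of_forall_mem_Ioo hy.2 (F := fun e => h x * (e - y) ^ p)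
      (G := fun e => h y * (e - x) ^ p) (by fun_prop) (by fun_prop) fun e he => ?_).2
    · exact h1
    · have hxe : 0 < e - x := by linarith [he.1]
      have hq : (y - e) / (x - e) = (e - y) / (e - x) := by
        rw [← neg_sub e y, ← neg_sub e x, neg_div_neg_eq]
      have := key e ⟨hy.1.trans he.1, he.2⟩ y hy x hx
        (by rw [hq]; exact div_nonneg (by linarith [he.1]) hxe.le)
        (by rw [hq]; exact (div_le_one hxe).2 (by linarith)) (by linarith)
      rw [← div_pow, hq, div_pow, div_mul_eq_mul_div, div_le_iff₀ (pow_pos hxe p)] at this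
      linarith

lemma IsConcaveWeight.isConeWeight {p : ℕ} (hp : 1 ≤ p) {d : ℝ} {h : ℝ → ℝ}
    (hw : IsConcaveWeight (p + 1) d h) : IsConeWeight p d h := by
  refine IsConeWeight.of_homothety hw.pos fun e he y hy s hs => ?_
  have hroot : ∀ x ∈ Ioo 0 d, (h x ^ (1 / (((p + 1 : ℕ) : ℝ) - 1))) ^ p = h x := fun x hx => by
    rw [one_div, Nat.cast_add, Nat.cast_one, add_sub_cancel_right]
    exact Real.rpow_inv_natCast_pow (hw.pos x hx).le (by omega)
  have hmem : (1 - s) * e + s * y ∈ Ioo 0 d :=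
    (convex_Ioo 0 d) he hy (by linarith [hs.2]) hs.1 (by ring)
  have hconc := hw.concave.2 he hy (by linarith [hs.2]) hs.1 (sub_add_cancel 1 s)
  simp only [smul_eq_mul] at hconc
  have hepos := Real.rpow_nonneg (hw.pos e he).le (1 / (((p + 1 : ℕ) : ℝ) - 1))
  have hypos := Real.rpow_nonneg (hw.pos y hy).le (1 / (((p + 1 : ℕ) : ℝ) - 1))
  rw [← hroot y hy, ← hroot _ hmem, ← mul_pow]
  -- The contribution of `e` to the concavity inequality is nonnegative and is dropped.
  refine pow_le_pow_left₀ (mul_nonneg hs.1 hypos) (le_trans ?_ hconc) p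
  linarith [mul_nonneg (sub_nonneg.2 hs.2) hepos]

/-! ### Slices of thin convex regions -/

namespace IsThinConvexRegion

variable {n : ℕ} {Ω : Set (Space n)} {d : ℝ}

lemma fst_mem (hΩ : IsThinConvexRegion n Ω d) {q : Space n} (hq : q ∈ Ω) : q.fst ∈ Icc 0 d :=
  ⟨hΩ.isGLB.1 (mem_image_of_mem _ hq), hΩ.isLUB.1 (mem_image_of_mem _ hq)⟩

/-- `Metric.diam` is `0` on unbounded sets, so the diameter bound on the projection controls
distances only once boundedness is known. -/
lemma isBounded_snd (hΩ : IsThinConvexRegion n Ω d) :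
    Bornology.IsBounded ((fun q : Space n => q.snd) '' Ω) := by
  obtain ⟨C, hC⟩ := Metric.isBounded_iff.1 hΩ.bounded
  rw [Metric.isBounded_iff]
  refine ⟨C, ?_⟩
  rintro _ ⟨q, hq, rfl⟩ _ ⟨q', hq', rfl⟩
  exact (WithLp.dist_snd_le q q').trans (hC hq hq')

lemma le_two (hΩ : IsThinConvexRegion n Ω d) : d ≤ 2 := by
  have h1 : ∀ q ∈ Ω, d - 2 ≤ q.fst := by
    intro q hq
    have : d ≤ 2 + q.fst := by
      refine hΩ.isLUB.2 ?_
      rintro _ ⟨q', hq', rfl⟩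
      have h2 := (WithLp.dist_fst_le q' q).trans
        ((Metric.dist_le_diam_of_mem hΩ.bounded hq' hq).trans_eq hΩ.diam_eq)
      rw [Real.dist_eq] at h2
      simp only
      linarith [le_abs_self (q'.fst - q.fst)]
    linarith
  have := hΩ.isGLB.2 (show d - 2 ∈ lowerBounds _ from by rintro _ ⟨q, hq, rfl⟩; exact h1 q hq)
  linarith

/-- If `d < 1`, Pythagoras bounds the diameter by the square root of `1 + 1 / 400`, which is less
than `3 / 2`. -/
lemma one_le (hΩ : IsThinConvexRegion n Ω d) : 1 ≤ d := by
  by_contra! hlt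
  have : Metric.diam Ω ≤ 3 / 2 := by
    refine Metric.diam_le_of_forall_dist_le (by norm_num) fun q hq q' hq' => ?_
    have h1 : dist q.fst q'.fst ≤ 1 := by
      rw [Real.dist_eq, abs_le]
      constructor <;> linarith [(hΩ.fst_mem hq).1, (hΩ.fst_mem hq).2, (hΩ.fst_mem hq').1,
        (hΩ.fst_mem hq').2]
    have h2 : dist q.snd q'.snd ≤ 1 / 20 :=
      (Metric.dist_le_diam_of_mem hΩ.isBounded_snd (mem_image_of_mem _ hq)
        (mem_image_of_mem _ hq')).trans hΩ.diam_proj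
    rw [WithLp.prod_dist_eq_of_L2]
    refine Real.sqrt_le_iff.2 ⟨by norm_num, ?_⟩
    nlinarith [dist_nonneg (x := q.fst) (y := q'.fst), dist_nonneg (x := q.snd) (y := q'.snd)]
  rw [hΩ.diam_eq] at this
  norm_num at this

lemma exists_fst_eq (hΩ : IsThinConvexRegion n Ω d) {e : ℝ} (he : e ∈ Ioo 0 d) :
    ∃ z : EuclideanSpace ℝ (Fin (n - 1)), WithLp.toLp 2 (e, z) ∈ Ω := by
  have hlow : ∃ q ∈ Ω, q.fst < e := by
    by_contra! hcon
    have := hΩ.isGLB.2 (show e ∈ lowerBounds _ from by rintro _ ⟨q, hq, rfl⟩; exact hcon q hq)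
    linarith [he.1]
  have hup : ∃ q ∈ Ω, e < q.fst := by
    by_contra! hcon
    have := hΩ.isLUB.2 (show e ∈ upperBounds _ from by rintro _ ⟨q, hq, rfl⟩; exact hcon q hq)
    linarith [he.2]
  obtain ⟨q, hq, hqe⟩ := hlow
  obtain ⟨q', hq', hqe'⟩ := hup
  have hpos : 0 < q'.fst - q.fst := by linarith
  have hmem := hΩ.convex hq hq' (a := (q'.fst - e) / (q'.fst - q.fst))
    (b := (e - q.fst) / (q'.fst - q.fst)) (div_nonneg (by linarith) hpos.le)
    (div_nonneg (by linarith) hpos.le) (by field_simp; ring)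
  set r := ((q'.fst - e) / (q'.fst - q.fst)) • q + ((e - q.fst) / (q'.fst - q.fst)) • q' with hr
  have hre : r.fst = e := by
    simp only [hr, WithLp.add_fst, WithLp.smul_fst, smul_eq_mul]
    field_simp
    ring
  exact ⟨r.snd, by rw [← hre]; exact hmem⟩

lemma volume_slice_ne_top (hΩ : IsThinConvexRegion n Ω d) (x : ℝ) :
    volume {y : EuclideanSpace ℝ (Fin (n - 1)) | WithLp.toLp 2 (x, y) ∈ Ω} ≠ ⊤ :=
  (hΩ.isBounded_snd.subset fun y hy => ⟨_, hy, rfl⟩).measure_lt_top.ne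

/-- Choose a point of the region over `e`. By convexity, the segments joining it to the slice over
`y` cut the intermediate hyperplane in a copy of that slice scaled by `s`, inside the region. -/
lemma homothety_le (hΩ : IsThinConvexRegion n Ω d) {e y s : ℝ} (he : e ∈ Ioo 0 d)
    (hs : s ∈ Icc (0 : ℝ) 1) :
    s ^ (n - 1) * sliceVolume Ω y ≤ sliceVolume Ω ((1 - s) * e + s * y) := by
  obtain ⟨z, hz⟩ := hΩ.exists_fst_eq he
  have hsub : AffineMap.homothety z s ''
      {w : EuclideanSpace ℝ (Fin (n - 1)) | WithLp.toLp 2 (y, w) ∈ Ω} ⊆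
      {w | WithLp.toLp 2 ((1 - s) * e + s * y, w) ∈ Ω} := by
    rintro _ ⟨w, hw, rfl⟩
    have h1 := hΩ.convex hz hw (by linarith [hs.2]) hs.1 (sub_add_cancel 1 s)
    have h2 : AffineMap.homothety z s w = (1 - s) • z + s • w := by
      rw [AffineMap.homothety_apply, vsub_eq_sub, vadd_eq_add, smul_sub, sub_smul, one_smul]
      abel
    rw [h2]
    exact h1
  have h3 := ENNReal.toReal_mono (hΩ.volume_slice_ne_top _) (measure_mono (μ := volume) hsub)
  rwa [Measure.addHaar_image_homothety, ENNReal.toReal_mul, finrank_euclideanSpace_fin,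
    abs_of_nonneg (pow_nonneg hs.1 _), ENNReal.toReal_ofReal (pow_nonneg hs.1 _)] at h3

lemma exists_sliceVolume_pos (hΩ : IsThinConvexRegion n Ω d) :
    ∃ c ∈ Ioo 0 d, 0 < sliceVolume Ω c := by
  obtain ⟨q, hq⟩ := hΩ.interior_nonempty
  have hq1 := hΩ.fst_mem (interior_subset hq)
  have hopen : IsOpen {t : ℝ | WithLp.toLp 2 (t, q.snd) ∈ interior Ω} :=
    isOpen_interior.preimage ((WithLp.prod_continuous_toLp 2 _ _).comp (by fun_prop))
  have hopen' : IsOpen {y : EuclideanSpace ℝ (Fin (n - 1)) |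
      WithLp.toLp 2 (q.fst, y) ∈ interior Ω} :=
    isOpen_interior.preimage ((WithLp.prod_continuous_toLp 2 _ _).comp (by fun_prop))
  obtain ⟨ε, hε, hball⟩ := Metric.isOpen_iff.1 hopen q.fst hq
  have hmem : ∀ t, |t - q.fst| < ε → t ∈ Icc 0 d := fun t ht =>
    hΩ.fst_mem (interior_subset (hball (by rwa [Metric.mem_ball, Real.dist_eq])))
  have h1 := (hmem (q.fst - ε / 2) (by rw [abs_lt]; constructor <;> linarith)).1
  have h2 := (hmem (q.fst + ε / 2) (by rw [abs_lt]; constructor <;> linarith)).2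
  refine ⟨q.fst, ⟨by linarith, by linarith⟩, ENNReal.toReal_pos ?_ (hΩ.volume_slice_ne_top _)⟩
  refine ((hopen'.measure_pos volume ⟨q.snd, hq⟩).trans_le (measure_mono ?_)).ne'
  exact fun y hy => interior_subset (s := Ω) hy

lemma isConeWeight (hΩ : IsThinConvexRegion n Ω d) : IsConeWeight (n - 1) d (sliceVolume Ω) := by
  refine IsConeWeight.of_homothety (fun x hx => ?_)
    fun e he _ _ s hs => hΩ.homothety_le he hs
  obtain ⟨c, hc, hcpos⟩ := hΩ.exists_sliceVolume_pos
  -- Positivity spreads from one slice over `c` to the slice over `x` by a homothety of positive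
  -- ratio; its centre is halfway between `x` and the end of the interval beyond `x` as seen from
  -- `c`.
  obtain ⟨e, he, s, hs, hs0, rfl⟩ : ∃ e ∈ Ioo 0 d, ∃ s ∈ Icc (0 : ℝ) 1, 0 < s ∧
      (1 - s) * e + s * c = x := by
    rcases lt_trichotomy x c with hlt | rfl | hgt
    · refine ⟨x / 2, ⟨by linarith [hx.1], by linarith [hx.1, hx.2]⟩, (x / 2) / (c - x / 2), ?_⟩
      have h0 : 0 < c - x / 2 := by linarith [hx.1]
      have h1 : 0 < (x / 2) / (c - x / 2) := div_pos (by linarith [hx.1]) h0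
      refine ⟨⟨h1.le, (div_le_one h0).2 (by linarith)⟩, h1, ?_⟩
      have h2 : 2 * c - x ≠ 0 := by linarith
      field_simp
      ring
    · exact ⟨x, hx, 1, by simp, one_pos, by ring⟩
    · refine ⟨(x + d) / 2, ⟨by linarith [hx.1, hx.2], by linarith [hx.2]⟩,
        ((d - x) / 2) / ((x + d) / 2 - c), ?_⟩
      have h0 : 0 < (x + d) / 2 - c := by linarith [hx.2]
      have h1 : 0 < ((d - x) / 2) / ((x + d) / 2 - c) := div_pos (by linarith [hx.2]) h0
      refine ⟨⟨h1.le, (div_le_one h0).2 (by linarith)⟩, h1, ?_⟩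
      have h2 : x + d - 2 * c ≠ 0 := by linarith
      field_simp
      ring
  exact (mul_pos (pow_pos hs0 _) hcpos).trans_le (hΩ.homothety_le he hs)

end IsThinConvexRegion

end WeightedNeumann

theorem mainTheorem9 (n : ℕ) (hn : 2 ≤ n) :
    ∃ C : ℝ, 0 < C ∧
      (∀ (d : ℝ) (h φ : ℝ → ℝ), 1 ≤ d → d ≤ 2 →
        WeightedNeumann.IsConcaveWeight n d h →
        WeightedNeumann.IsFirstNeumannEigenfunction d h φ →
        WeightedNeumann.Estimates n C d φ) ∧
      (∀ (Ω : Set (WeightedNeumann.Space n)) (d : ℝ) (φ : ℝ → ℝ),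
        WeightedNeumann.IsThinConvexRegion n Ω d →
        WeightedNeumann.IsFirstNeumannEigenfunction d (WeightedNeumann.sliceVolume Ω) φ →
        WeightedNeumann.Estimates n C d φ) := by
  obtain ⟨p, rfl⟩ : ∃ p, n = p + 1 := ⟨n - 1, by omega⟩
  have hp : 1 ≤ p := by omega
  refine ⟨96 * 8 ^ p * (768 * 4 ^ p * (2 * 10 ^ (p + 1)) ^ p), by positivity, ?_, ?_⟩
  · intro d h φ hd hd2 hw hφ
    exact hφ.estimates (hw.isConeWeight hp) hp hd hd2
  · intro Ω d φ hΩ hφ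
    exact hφ.estimates hΩ.isConeWeight hp hΩ.one_le hΩ.le_two
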